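/- **Setting.** Consider the feedback loop $e=r-\mathcal C_4y$, $z=\mathcal C_1e$, $v=\mathcal C_r z+\mathcal C_2z$, $u=\mathcal C_3v$, $y=\mathcal Pu$, $z_s=\mathcal C_sz$, where $\mathcal C_1,\mathcal C_2,\mathcal C_3,\mathcal C_4,\mathcal C_s,\mathcal P$ are finite-dimensional real SISO LTI systems (proper transfer functions) and $\mathcal C_r$ is the reset controller $\dot x_r=A_Rx_r+B_Rz$ for $t\notin J$, $x_r(t^+)=A_\rho x_r(t)$ for $t\in J$, $m=C_Rx_r+D_Rz$, with $A_\rho=\mathrm{diag}(\gamma,1,\dots,1)$, $\gamma\in(-1,1]$, and zero-crossing law $J=\{t: z_s(t)=0\}$. There is no direct feedthrough around the loop (the product of the feedthrough gains of $\mathcal C_1,\mathcal C_3,\mathcal P,\mathcal C_4$ is $0$; e.g. the plant is strictly proper). Assume the $H_\beta$ condition: the base-linear closed loop (no resets), with system matrix $A_{cl}$, is Hurwitz, and there are $\beta\in\mathbb R$ and $p>0$ such that $[\beta c_{z_s}+pB_0^{T}](sI-A_{cl})^{-1}B_0$ is strictly positive real, where $B_0$ is the unit vector of the reset state (the first state of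 $\mathcal C_r$) and $c_{z_s}$ is the row expressing $z_s$ through the closed-loop state. Let $r(t)=|R|\sin\omega t$ with $|R|>0$, $\omega>0$, and consider any $2\pi/\omega$-periodic steady-state response. For a signal $f$ write its $n$th harmonic as $|F^n|\sin(n\omega t+\angle F^n)$, $F^n=|F^n|e^{j\angle F^n}$. Two-reset assumption: $Z_s^1\neq0$ and $z_s$ vanishes exactly at the zeros of its first harmonic $z_s^1(t)=|Z_s^1|\sin(\omega t+\angle Z_s^1)$ (in particular this holds if $z_s=z_s^1\ne 0$), so that $J=\{(\eta\pi-\angle Z_s^1)/\omega\}$. **Notation.** For an LTI block write $\mathcal C(n\omega)$ for its transfer function at $jn\omega$; $\mathcal C_l(n\omega)=C_R(jn\omega I-A_R)^{-1}B_R+D_R$. Put $\Delta_l(n\omega)=(jn\omega I-A_R)^{-1}B_R$, $\Delta_x(n\omega)=C_R(jn\omega I-A_R)^{-1}jn\omega$, $\Delta_c(\omega)=|\Delta_l(\omega)|\sin(\angle\Delta_l(\omega)-\angle\mathcal C_s(\omega))$ (componentwise), $\Delta_q(\omega)=(I+e^{A_R\pi/\omega})(A_\rho e^{A_R\pi/\omega}+I)^{-1}(A_\rho-I)\Delta_c(\omega)$,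 $\mathcal C_\rho^n(\omega)=2\Delta_x(n\omega)\Delta_q(\omega)e^{jn\angle\mathcal C_s(\omega)}/(n\pi)$, $$\mathcal L_n(\omega)=\begin{cases}\mathcal C_1(\omega)[\mathcal C_l(\omega)+\mathcal C_\rho^1(\omega)+\mathcal C_2(\omega)]\mathcal C_3(\omega)\mathcal P(\omega),&n=1,\\ \mathcal C_1(\omega)e^{j(n-1)\angle\mathcal C_1(\omega)}\mathcal C_\rho^n(\omega)\mathcal C_3(n\omega)\mathcal P(n\omega),&n>1\text{ odd},\end{cases}$$ $\mathcal L_l(n\omega)=[\mathcal C_l(n\omega)+\mathcal C_2(n\omega)]\mathcal C_3(n\omega)\mathcal P(n\omega)\mathcal C_4(n\omega)\mathcal C_1(n\omega)$, $\mathcal L_\rho(n\omega)=\mathcal C_\rho^n(\omega)\mathcal C_3(n\omega)\mathcal P(n\omega)\mathcal C_4(n\omega)\mathcal C_1(n\omega)$, $\mathcal S_l(n\omega)=1/(1+\mathcal L_l(n\omega))$, $\Psi_n(\omega)=|\mathcal L_\rho(n\omega)|/|1+\mathcal L_l(n\omega)|$. Let $\Delta_c^1(\omega)$ be the reset-state (first)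 component of $\Delta_c(\omega)$ and, with $\Delta_{l,1}$ the first component of $\Delta_l$, let $\Delta_c^n(\omega)=-|\Delta_{l,1}(n\omega)|\sin(\angle\Delta_{l,1}(n\omega)+\angle\mathcal L_\rho(n\omega)-\angle(1+\mathcal L_l(n\omega))-n\angle\mathcal C_s(\omega))$ for $n>1$. Finally $$\Gamma(\omega)=\frac1{1-\sum_{n=3,5,7,\dots}\Psi_n(\omega)\Delta_c^n(\omega)/\Delta_c^1(\omega)},\qquad \mathcal L_o(\omega)=\mathcal L_1(\omega)\mathcal C_4(\omega)+(\Gamma(\omega)-1)\mathcal L_\rho(\omega).$$ Assume these are meaningful: no block has an eigenvalue $jn\omega$ with $n$ odd, $A_\rho e^{A_R\pi/\omega}+I$ is invertible, and $\Delta_c^1(\omega)\ne0$. **Claim.** The series in $\Gamma(\omega)$ converges, its denominator, $1+\mathcal L_o(\omega)$ and all $1+\mathcal L_l(n\omega)$ ($n$ odd) are nonzero, and with $R^n$ the phasor of $r^n(t)=|R|\sin n\omega t$ the functions $\mathcal S_n=E^n/R^n$, $\mathcal T_n=Y^n/R^n$, $\mathcal{CS}_n=U^n/R^n$ are as follows.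 For $n=1$: $\mathcal S_1=\frac{1}{1+\mathcal L_o(\omega)}$, $\mathcal T_1=\frac{\mathcal L_o(\omega)}{\mathcal C_4(\omega)(1+\mathcal L_o(\omega))}$, $\mathcal{CS}_1=\frac{\mathcal L_o(\omega)}{\mathcal C_4(\omega)\mathcal P(\omega)(1+\mathcal L_o(\omega))}$. For odd $n>1$: $\mathcal T_n=\mathcal S_l(n\omega)\,|\mathcal S_1(\omega)|e^{jn\angle\mathcal S_1(\omega)}\,\Gamma(\omega)\mathcal L_n(\omega)$, $\mathcal S_n=-\mathcal T_n\,\mathcal C_4(n\omega)$, $\mathcal{CS}_n=\mathcal T_n/\mathcal P(n\omega)$. For even $n\ge2$: $\mathcal S_n=\mathcal T_n=\mathcal{CS}_n=0$. (Formulas that divide by $\mathcal C_4(\omega)$ or $\mathcal P(n\omega)$ are claimed when these are nonzero.) -/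

import Mathlib

open scoped Matrix

noncomputable section

/-- A finite-dimensional real single-input single-output LTI system
`x' = A x + B u`, `output = C x + D u`. -/
structure LTI where
  order : ℕ
  A : Matrix (Fin order) (Fin order) ℝ
  B : Fin order → ℝ
  C : Fin order → ℝ
  D : ℝ

namespace LTI

/-- The matrix `s I - A` over `ℂ`. -/
def charMat (G : LTI) (s : ℂ) : Matrix (Fin G.order) (Fin G.order) ℂ :=
  s • (1 : Matrix (Fin G.order) (Fin G.order) ℂ) - G.A.map Complex.ofReal

/-- Input-to-state transfer vector `(s I - A)⁻¹ B`. -/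
def stateTF (G : LTI) (s : ℂ) : Fin G.order → ℂ :=
  (G.charMat s)⁻¹ *ᵥ (fun i => (G.B i : ℂ))

/-- Transfer function `C (s I - A)⁻¹ B + D`. -/
def tf (G : LTI) (s : ℂ) : ℂ :=
  (fun i => (G.C i : ℂ)) ⬝ᵥ G.stateTF s + (G.D : ℂ)

end LTI

/-- The blocks of the feedback loop. -/
inductive Block where
  | Cr | C1 | C2 | C3 | C4 | Cs | P
  deriving DecidableEq

instance : Fintype Block where
  elems := {Block.Cr, Block.C1, Block.C2, Block.C3, Block.C4, Block.Cs, Block.P}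
  complete := by intro b; cases b <;> decide

/-- The generalized reset feedback system: an LTI system for each block (for `Cr` it is the
base-linear controller `(A_R, B_R, C_R, D_R)`), and the reset value `γ` of the single reset
state, which is the first state of `Cr`. -/
structure ResetLoop where
  sys : Block → LTI
  order_pos : 0 < (sys Block.Cr).order
  γ : ℝ
  γ_mem : γ ∈ Set.Ioc (-1 : ℝ) 1

/-- Sinusoidal phasor of the `n`-th harmonic of a `2π/ω`-periodic signal `f`: the complex number
`F` such that the `n`-th harmonic of `f` is `‖F‖ * sin (n ω t + arg F)`. -/
def phasor (ω : ℝ) (n : ℕ) (f : ℝ → ℝ) : ℂ :=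
  2 * Complex.I * ((ω / (2 * Real.pi) : ℝ) : ℂ) *
    ∫ t in (0 : ℝ)..(2 * Real.pi / ω),
      (f t : ℂ) * Complex.exp (-(Complex.I * ((n * ω * t : ℝ) : ℂ)))

/-- A (rational) function `H` is strictly positive real if, for some `ε > 0`, the function
`s ↦ H (s - ε)` is analytic with nonnegative real part on the open right half plane. -/
def StrictlyPositiveReal (H : ℂ → ℂ) : Prop :=
  ∃ ε : ℝ, 0 < ε ∧ AnalyticOnNhd ℂ H {s | -ε < s.re} ∧ ∀ s : ℂ, -ε < s.re → 0 ≤ (H s).re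

/-- All eigenvalues lie in the open left half plane. -/
def HurwitzMatrix {ι : Type} [Fintype ι] [DecidableEq ι] (M : Matrix ι ι ℝ) : Prop :=
  ∀ μ ∈ spectrum ℂ (M.map Complex.ofReal), μ.re < 0

namespace ResetLoop

variable (S : ResetLoop)

/-- Index of the reset state inside the state of `Cr`. -/
def rho : Fin (S.sys Block.Cr).order := ⟨0, S.order_pos⟩

/-- The reset matrix `A_ρ = diag(γ, 1, …, 1)`. -/
def Arho : Matrix (Fin (S.sys Block.Cr).order) (Fin (S.sys Block.Cr).order) ℝ :=
  Matrix.diagonal (fun i => if i = S.rho then S.γ else 1)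

/-! ### The closed loop in the time domain -/

/-- Index set of the state of the whole closed loop. -/
abbrev Idx : Type := Σ b : Block, Fin (S.sys b).order

/-- Output of block `b` when the state is `x` and the inputs of the blocks are `inp`. -/
def out (x : S.Idx → ℝ) (inp : Block → ℝ) (b : Block) : ℝ :=
  (S.sys b).C ⬝ᵥ (fun i => x ⟨b, i⟩) + (S.sys b).D * inp b

/-- The block diagram with reference value `r`: the error `e = r - (output of C4)` enters `C1`,
the output `z` of `C1` enters `Cr`, `C2` and the shaping filter `Cs`, the sum `v` of the outputs
of `Cr` and `C2` enters `C3`, the control input `u` (output of `C3`) enters the plant, and the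
plant output `y` enters `C4`. -/
structure Diagram (x : S.Idx → ℝ) (r : ℝ) (inp : Block → ℝ) : Prop where
  e_eq : inp Block.C1 = r - S.out x inp Block.C4
  zr_eq : inp Block.Cr = S.out x inp Block.C1
  z2_eq : inp Block.C2 = S.out x inp Block.C1
  zs_eq : inp Block.Cs = S.out x inp Block.C1
  v_eq : inp Block.C3 = S.out x inp Block.Cr + S.out x inp Block.C2
  u_eq : inp Block.P = S.out x inp Block.C3
  y_eq : inp Block.C4 = S.out x inp Block.P

/-- Right-hand side of the flow dynamics of all blocks. -/
def field (x : S.Idx → ℝ) (inp : Block → ℝ) : S.Idx → ℝ :=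
  fun q => ((S.sys q.1).A *ᵥ (fun i => x ⟨q.1, i⟩)) q.2 + (S.sys q.1).B q.2 * inp q.1

/-- The jump: `A_ρ` acts on the state of `Cr`; all other states are unchanged. -/
def jump (x : S.Idx → ℝ) : S.Idx → ℝ
  | ⟨Block.Cr, i⟩ => (S.Arho *ᵥ (fun k => x ⟨Block.Cr, k⟩)) i
  | q => x q

/-- The reset-triggered signal `z_s`, the output of the shaping filter. -/
def trigger (x : ℝ → S.Idx → ℝ) (inp : ℝ → Block → ℝ) (t : ℝ) : ℝ :=
  S.out (x t) (inp t) Block.Cs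

/-- The set of reset instants given by the zero-crossing law. -/
def resetInstants (x : ℝ → S.Idx → ℝ) (inp : ℝ → Block → ℝ) : Set ℝ :=
  {t | S.trigger x inp t = 0}

/-- `x` (with block inputs `inp`) is a `2π/ω`-periodic steady-state response of the closed-loop
reset system to `r(t) = R sin(ωt)`. At a reset instant `t` the value `x t` is the value just
before the reset. -/
structure IsSteadyState (ω R : ℝ) (x : ℝ → S.Idx → ℝ) (inp : ℝ → Block → ℝ) : Prop where
  diagram : ∀ t, S.Diagram (x t) (R * Real.sin (ω * t)) (inp t)
  flow : ∀ t, t ∉ S.resetInstants x inp → HasDerivAt x (S.field (x t) (inp t)) t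
  left_cont : ∀ t ∈ S.resetInstants x inp, ContinuousWithinAt x (Set.Iic t) t
  reset : ∀ t ∈ S.resetInstants x inp,
    Filter.Tendsto x (nhdsWithin t (Set.Ioi t)) (nhds (S.jump (x t)))
  periodic : Function.Periodic x (2 * Real.pi / ω)

/-- Two resets per cycle, governed by the first harmonic of the trigger signal: the first harmonic
`z_s¹` of `z_s` is not zero, and `z_s` vanishes exactly where `z_s¹` does. This holds in
particular if `z_s = z_s¹ ≠ 0`. -/
structure IsTwoReset (ω : ℝ) (x : ℝ → S.Idx → ℝ) (inp : ℝ → Block → ℝ) : Prop where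
  first_ne_zero : phasor ω 1 (S.trigger x inp) ≠ 0
  zeros : ∀ t, S.trigger x inp t = 0 ↔
    ‖phasor ω 1 (S.trigger x inp)‖ *
      Real.sin (ω * t + (phasor ω 1 (S.trigger x inp)).arg) = 0

/-! ### The `H_β` condition -/

/-- `Acl` is the system matrix of the unforced base-linear closed loop and `czs` is the row that
expresses the trigger signal `z_s` through its state. -/
def IsBaseLinear (Acl : Matrix S.Idx S.Idx ℝ) (czs : S.Idx → ℝ) : Prop :=
  ∀ x inp, S.Diagram x 0 inp →
    S.field x inp = Acl *ᵥ x ∧ S.out x inp Block.Cs = czs ⬝ᵥ x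

/-- Unit vector of the reset state in the closed-loop state space. -/
def eRho : S.Idx → ℝ := Pi.single ⟨Block.Cr, S.rho⟩ 1

/-- The `H_β` condition: the base-linear closed loop is Hurwitz, and for some `β ∈ ℝ` and
`p > 0` the transfer function `H_β(s) = C₀ (s I - A_cl)⁻¹ B₀` is strictly positive real, where
`B₀` is the unit vector of the reset state and `C₀ = β c_zs + p B₀ᵀ`. -/
def HBeta : Prop :=
  ∃ (Acl : Matrix S.Idx S.Idx ℝ) (czs : S.Idx → ℝ) (β p : ℝ),
    S.IsBaseLinear Acl czs ∧ HurwitzMatrix Acl ∧ 0 < p ∧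
    StrictlyPositiveReal (fun s =>
      (fun q => ((β * czs q + p * S.eRho q : ℝ) : ℂ)) ⬝ᵥ
        ((s • (1 : Matrix S.Idx S.Idx ℂ) - Acl.map Complex.ofReal)⁻¹ *ᵥ
          (fun q => (S.eRho q : ℂ))))

/-! ### Open-loop frequency-domain quantities -/

/-- The complex frequency `j n ω`. -/
def jw (ω : ℝ) (n : ℕ) : ℂ := Complex.I * ((n * ω : ℝ) : ℂ)

/-- Frequency response of block `b` at `n ω`; for `Cr` this is `C_l(nω)`. -/
def fr (ω : ℝ) (n : ℕ) (b : Block) : ℂ := (S.sys b).tf (jw ω n)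

/-- `Δ_l(nω) = (jnωI - A_R)⁻¹ B_R`. -/
def DeltaL (ω : ℝ) (n : ℕ) : Fin (S.sys Block.Cr).order → ℂ :=
  (S.sys Block.Cr).stateTF (jw ω n)

/-- The row vector `Δ_x(nω) = C_R (jnωI - A_R)⁻¹ jnω`. -/
def DeltaX (ω : ℝ) (n : ℕ) : Fin (S.sys Block.Cr).order → ℂ :=
  jw ω n • ((fun i => ((S.sys Block.Cr).C i : ℂ)) ᵥ* ((S.sys Block.Cr).charMat (jw ω n))⁻¹)

/-- `Δ_c(ω) = |Δ_l(ω)| sin(∠Δ_l(ω) - ∠C_s(ω))`, componentwise. -/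
def DeltaC (ω : ℝ) : Fin (S.sys Block.Cr).order → ℝ := fun i =>
  ‖S.DeltaL ω 1 i‖ * Real.sin ((S.DeltaL ω 1 i).arg - (S.fr ω 1 Block.Cs).arg)

/-- The matrix exponential `e^{A_R π/ω}`. -/
def expAR (ω : ℝ) : Matrix (Fin (S.sys Block.Cr).order) (Fin (S.sys Block.Cr).order) ℝ :=
  NormedSpace.exp ((Real.pi / ω) • (S.sys Block.Cr).A)

/-- `Δ_q(ω) = (I + e^{A_R π/ω}) (A_ρ e^{A_R π/ω} + I)⁻¹ (A_ρ - I) Δ_c(ω)`. -/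
def DeltaQ (ω : ℝ) : Fin (S.sys Block.Cr).order → ℝ :=
  ((1 + S.expAR ω) * (S.Arho * S.expAR ω + 1)⁻¹ * (S.Arho - 1)) *ᵥ S.DeltaC ω

/-- `C_ρⁿ(ω) = 2 Δ_x(nω) Δ_q(ω) e^{jn∠C_s(ω)} / (nπ)`. -/
def Crho (ω : ℝ) (n : ℕ) : ℂ :=
  2 * (S.DeltaX ω n ⬝ᵥ (fun i => (S.DeltaQ ω i : ℂ))) *
    Complex.exp (Complex.I * ((n * (S.fr ω 1 Block.Cs).arg : ℝ) : ℂ)) / ((n * Real.pi : ℝ) : ℂ)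

/-- The open-loop higher-order describing function `L_n(ω)`. -/
def Ln (ω : ℝ) (n : ℕ) : ℂ :=
  if n = 1 then
    S.fr ω 1 Block.C1 * (S.fr ω 1 Block.Cr + S.Crho ω 1 + S.fr ω 1 Block.C2) *
      S.fr ω 1 Block.C3 * S.fr ω 1 Block.P
  else if Odd n then
    S.fr ω 1 Block.C1 *
      Complex.exp (Complex.I * ((((n : ℝ) - 1) * (S.fr ω 1 Block.C1).arg : ℝ) : ℂ)) *
      S.Crho ω n * S.fr ω n Block.C3 * S.fr ω n Block.P
  else 0

/-! ### Closed-loop frequency-domain quantities -/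

/-- `L_l(nω)`, the loop gain of the base-linear system. -/
def Ll (ω : ℝ) (n : ℕ) : ℂ :=
  (S.fr ω n Block.Cr + S.fr ω n Block.C2) * S.fr ω n Block.C3 * S.fr ω n Block.P *
    S.fr ω n Block.C4 * S.fr ω n Block.C1

/-- `L_ρ(nω)`. -/
def Lrho (ω : ℝ) (n : ℕ) : ℂ :=
  S.Crho ω n * S.fr ω n Block.C3 * S.fr ω n Block.P * S.fr ω n Block.C4 * S.fr ω n Block.C1

/-- `S_l(nω) = 1/(1 + L_l(nω))`. -/
def Sl (ω : ℝ) (n : ℕ) : ℂ := 1 / (1 + S.Ll ω n)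

/-- `Ψ_n(ω) = |L_ρ(nω)|/|1 + L_l(nω)|`. -/
def Psi (ω : ℝ) (n : ℕ) : ℝ := ‖S.Lrho ω n‖ / ‖1 + S.Ll ω n‖

/-- The reset-state component of `Δ_c¹(ω)`. -/
def DeltaC1 (ω : ℝ) : ℝ := S.DeltaC ω S.rho

/-- The reset-state component of `Δ_cⁿ(ω)`, `n > 1`. -/
def DeltaCn (ω : ℝ) (n : ℕ) : ℝ :=
  -(‖S.DeltaL ω n S.rho‖ * Real.sin ((S.DeltaL ω n S.rho).arg + (S.Lrho ω n).arg
    - (1 + S.Ll ω n).arg - n * (S.fr ω 1 Block.Cs).arg))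

/-- The sum `∑_{n = 3, 5, 7, …} Ψ_n(ω) Δ_cⁿ(ω)`. -/
def PsiSum (ω : ℝ) : ℝ := ∑' k : ℕ, S.Psi ω (2 * k + 3) * S.DeltaCn ω (2 * k + 3)

/-- `Γ(ω)`. -/
def Gam (ω : ℝ) : ℝ := 1 / (1 - S.PsiSum ω / S.DeltaC1 ω)

/-- `L_o(ω) = L_1(ω) C_4(ω) + (Γ(ω) - 1) L_ρ(ω)`. -/
def Lo (ω : ℝ) : ℂ :=
  S.Ln ω 1 * S.fr ω 1 Block.C4 + ((S.Gam ω : ℂ) - 1) * S.Lrho ω 1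

/-- The formula `1/(1 + L_o(ω))`. -/
def S1 (ω : ℝ) : ℂ := 1 / (1 + S.Lo ω)

/-- The common factor `S_l(nω) |S_1(ω)| e^{jn∠S_1(ω)} Γ(ω) L_n(ω)`. -/
def hoFactor (ω : ℝ) (n : ℕ) : ℂ :=
  S.Sl ω n * ((‖S.S1 ω‖ : ℂ) * Complex.exp (Complex.I * ((n * (S.S1 ω).arg : ℝ) : ℂ))) *
    (S.Gam ω : ℂ) * S.Ln ω n

end ResetLoop

/-- The `n`-th higher-order describing function from `r(t) = R sin(ωt)` to a `2π/ω`-periodic signal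
`f`: the ratio of the `n`-th harmonic of `f` to the virtual harmonic `rⁿ(t) = R sin(nωt)`. -/
def hosidf (ω R : ℝ) (f : ℝ → ℝ) (n : ℕ) : ℂ :=
  phasor ω n f / phasor ω n (fun t => R * Real.sin (n * ω * t))

end

/-! Half a period apart, the reference changes sign and the reset instants are mapped to reset
instants. So the sum `w` of the state and its shift by `π/ω` is a `π/ω`-periodic response of the
unforced base-linear loop, reset once per period. By positive realness of `H_β` at the harmonics,
`w_ρ` jumps by an amount whose product with the sum of the two one-sided limits of
`(β c_{z_s} + p B₀ᵀ) w` is nonnegative; since `c_{z_s} w = 0` at the reset, that product is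
`-p (1 - γ²) w_ρ²`. Hence `w` does not jump, and it vanishes because `A_cl` has no eigenvalue at a
harmonic. The steady state is therefore half-wave antisymmetric, and its even harmonics are zero.

For odd harmonics the jump of the state of `Cr` is `κ Δ_q` for a real amplitude `κ`, and the loop
equations are linear in the phasors, with `κ` as an additional source. The amplitude follows from
evaluating at a reset instant the Fourier series of the part of the reset state that the
base-linear controller produces: this gives `κ Δ_c¹ = |Z¹| Δ_c¹ + κ ∑ Ψ_n Δ_cⁿ`, that is
`κ = Γ |Z¹|`. -/

section

open Set MeasureTheory Filter Topology
open ResetLoop (jw)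

/-! ### Fourier series on an interval -/

section FourierSeries

variable {a b : ℝ} {f f' : ℝ → ℂ}

theorem fourierCoeffOn_eq_of_hasDerivAt_of_eq (hab : a < b) (hf : ContinuousOn f (Icc a b))
    (hd : ∀ x ∈ Ioo a b, HasDerivAt f (f' x) x) (hf' : ContinuousOn f' (Icc a b))
    (h : f a = f b) {n : ℤ} (hn : n ≠ 0) :
    fourierCoeffOn hab f n =
      ((b - a : ℝ) : ℂ) / (2 * Real.pi * Complex.I * n) * fourierCoeffOn hab f' n := by
  rw [fourierCoeffOn_of_hasDerivAt_Ioo hab hn (by rwa [uIcc_of_le hab.le])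
    (by rwa [min_eq_left hab.le, max_eq_right hab.le]) (hf'.intervalIntegrable_of_Icc hab.le), h]
  push_cast
  ring

theorem summable_fourierCoeffOn (hab : a < b) (hf : ContinuousOn f (Icc a b))
    (hd : ∀ x ∈ Ioo a b, HasDerivAt f (f' x) x) (hf' : ContinuousOn f' (Icc a b))
    (h : f a = f b) : Summable (fourierCoeffOn hab f) := by
  have hL2 : MemLp f' 2 (volume.restrict (Ioc a b)) := by
    obtain ⟨C, hC⟩ := isCompact_Icc.exists_bound_of_continuousOn hf'
    exact .of_bound ((hf'.mono Ioc_subset_Icc_self).aestronglyMeasurable measurableSet_Ioc) C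
      ((ae_restrict_iff' measurableSet_Ioc).2 <| .of_forall fun x hx =>
        hC x (Ioc_subset_Icc_self hx))
  have hsq := (hasSum_sq_fourierCoeffOn hab hL2).summable
  have hinv : Summable fun n : ℤ => 1 / (n : ℝ) ^ 2 := Real.summable_one_div_int_pow.2 one_lt_two
  refine .of_norm_bounded_eventually ((hsq.add hinv).mul_left (b - a)) ?_
  filter_upwards [Filter.eventually_cofinite_ne (0 : ℤ)] with n hn
  have hba : 0 < b - a := sub_pos.2 hab
  have : 0 < |(n : ℝ)| := abs_pos.2 (by exact_mod_cast hn)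
  set c := ‖fourierCoeffOn hab f' n‖
  calc ‖fourierCoeffOn hab f n‖ = (b - a) / (2 * Real.pi * |(n : ℝ)|) * c := by
        rw [fourierCoeffOn_eq_of_hasDerivAt_of_eq hab hf hd hf' h hn]
        simp [-Complex.ofReal_sub, abs_of_pos Real.pi_pos, abs_of_pos hba, c]
    _ ≤ (b - a) / (1 * |(n : ℝ)|) * c := by
        gcongr
        nlinarith [Real.pi_gt_three]
    _ = (b - a) * (c * (1 / |(n : ℝ)|)) := by ring
    _ ≤ (b - a) * (c ^ 2 + (1 / |(n : ℝ)|) ^ 2) := by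
        gcongr
        nlinarith [two_mul_le_add_sq c (1 / |(n : ℝ)|), sq_nonneg c, sq_nonneg (1 / |(n : ℝ)|)]
    _ = (b - a) * (c ^ 2 + 1 / (n : ℝ) ^ 2) := by rw [div_pow, sq_abs, one_pow]

theorem hasSum_fourierCoeffOn_mul_fourier (hab : a < b) (hf : ContinuousOn f (Icc a b))
    (hd : ∀ x ∈ Ioo a b, HasDerivAt f (f' x) x) (hf' : ContinuousOn f' (Icc a b))
    (h : f a = f b) {x : ℝ} (hx : x ∈ Icc a b) :
    HasSum (fun n : ℤ => fourierCoeffOn hab f n * fourier n (x : AddCircle (b - a))) (f x) := by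
  have := Fact.mk (sub_pos.2 hab)
  have hb : a + (b - a) = b := add_sub_cancel a b
  have hcont : Continuous (AddCircle.liftIoc (b - a) a f) :=
    AddCircle.liftIoc_continuous (by rw [hb, h]) (by rwa [hb])
  have hval : AddCircle.liftIoc (b - a) a f (x : AddCircle (b - a)) = f x := by
    rcases hx.1.eq_or_lt with rfl | hlt
    · rw [← AddCircle.coe_add_period (b - a) a, AddCircle.liftIoc_coe_apply, hb, h]
      simpa only [hb] using right_mem_Ioc.2 hab
    · exact AddCircle.liftIoc_coe_apply (by rw [hb]; exact ⟨hlt, hx.2⟩)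
  have key := has_pointwise_sum_fourier_series_of_summable
    (f := (⟨_, hcont⟩ : C(AddCircle (b - a), ℂ))) (h := summable_fourierCoeffOn hab hf hd hf' h) x
  rwa [ContinuousMap.coe_mk, hval] at key

end FourierSeries

/-! ### Exponential integrals over an interval -/

/-- The exponential integral `∫ f(t) e^{-st} dt` of a real signal over `[a, b]`. It carries both
the phasors of a periodic signal and the Laplace-type transform of a linear flow between resets. -/
noncomputable def expIntegral (a b : ℝ) (s : ℂ) (f : ℝ → ℝ) : ℂ :=
  ∫ t in a..b, (f t : ℂ) * Complex.exp (-(s * t))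

section ExpIntegral

variable {a b : ℝ} {s : ℂ} {f g : ℝ → ℝ}

theorem hasDerivAt_cexp_neg_mul (s : ℂ) (t : ℝ) :
    HasDerivAt (fun t : ℝ => Complex.exp (-(s * t))) (-s * Complex.exp (-(s * t))) t := by
  have hlin : HasDerivAt (fun t : ℝ => -(s * (t : ℂ))) (-(s * 1)) t :=
    (Complex.ofRealCLM.hasDerivAt.const_mul s).neg
  convert hlin.cexp using 1
  ring

theorem intervalIntegrable_mul_cexp (hf : IntervalIntegrable f volume a b) (s : ℂ) :
    IntervalIntegrable (fun t : ℝ => (f t : ℂ) * Complex.exp (-(s * t))) volume a b :=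
  IntervalIntegrable.mul_continuousOn ⟨hf.1.ofReal, hf.2.ofReal⟩ (by fun_prop)

@[simp]
theorem expIntegral_zero : expIntegral a b s (fun _ => 0) = 0 := by
  simp [expIntegral]

theorem expIntegral_congr (hab : a ≤ b) (h : EqOn f g (Ioc a b)) :
    expIntegral a b s f = expIntegral a b s g := by
  refine intervalIntegral.integral_congr_ae (ae_of_all _ fun t ht => ?_)
  rw [uIoc_of_le hab] at ht
  rw [h ht]

theorem expIntegral_add (hf : IntervalIntegrable f volume a b)
    (hg : IntervalIntegrable g volume a b) :
    expIntegral a b s (fun t => f t + g t) = expIntegral a b s f + expIntegral a b s g := by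
  simp only [expIntegral, Complex.ofReal_add, add_mul]
  exact intervalIntegral.integral_add (intervalIntegrable_mul_cexp hf s)
    (intervalIntegrable_mul_cexp hg s)

theorem expIntegral_const_mul (c : ℝ) :
    expIntegral a b s (fun t => c * f t) = c * expIntegral a b s f := by
  simp only [expIntegral, Complex.ofReal_mul, mul_assoc, intervalIntegral.integral_const_mul]

theorem expIntegral_dotProduct {ι : Type*} [Fintype ι] (c : ι → ℝ) {X : ℝ → ι → ℝ}
    (hX : ∀ i, IntervalIntegrable (fun t => X t i) volume a b) :
    expIntegral a b s (fun t => c ⬝ᵥ X t) =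
      (fun i => (c i : ℂ)) ⬝ᵥ fun i => expIntegral a b s (fun t => X t i) := by
  simp only [dotProduct, ← expIntegral_const_mul]
  simp only [expIntegral, Complex.ofReal_sum, Finset.sum_mul]
  exact intervalIntegral.integral_finsetSum fun i _ =>
    intervalIntegrable_mul_cexp ((hX i).const_mul (c i)) s

theorem expIntegral_deriv (hab : a ≤ b) (hf : ContinuousOn f (Icc a b)) {f' : ℝ → ℝ}
    (hd : ∀ t ∈ Ioo a b, HasDerivAt f (f' t) t) (hf' : ContinuousOn f' (Icc a b)) :
    expIntegral a b s f' =
      f b * Complex.exp (-(s * b)) - f a * Complex.exp (-(s * a)) + s * expIntegral a b s f := by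
  have hexp : Continuous fun t : ℝ => Complex.exp (-(s * t)) := by fun_prop
  have hparts := intervalIntegral.integral_mul_deriv_eq_deriv_mul_of_hasDerivAt
    (u := fun t => (f t : ℂ)) (u' := fun t => (f' t : ℂ))
    (by rw [uIcc_of_le hab]; exact Complex.continuous_ofReal.comp_continuousOn hf)
    hexp.continuousOn
    (fun t ht => (hd t (by rwa [min_eq_left hab, max_eq_right hab] at ht)).ofReal_comp)
    (fun t _ => hasDerivAt_cexp_neg_mul s t)
    ((Complex.continuous_ofReal.comp_continuousOn hf').intervalIntegrable_of_Icc hab)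
    ((continuous_const.mul hexp).intervalIntegrable a b)
  simp only [mul_left_comm _ (-s), intervalIntegral.integral_const_mul] at hparts
  change -s * expIntegral a b s f = _ - expIntegral a b s f' at hparts
  linear_combination hparts

theorem expIntegral_reflect :
    expIntegral a b s (fun t => f (a + b - t)) =
      Complex.exp (-(s * (a + b : ℝ))) * expIntegral a b (-s) f := by
  have hsub := intervalIntegral.integral_comp_sub_left (a := a) (b := b)
    (fun t : ℝ => (f t : ℂ) * Complex.exp (-(s * ((a + b : ℝ) - t)))) (a + b)
  rw [add_sub_cancel_right, add_sub_cancel_left] at hsub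
  simp only [expIntegral, ← intervalIntegral.integral_const_mul]
  refine (intervalIntegral.integral_congr fun t _ => ?_).trans
    (hsub.trans (intervalIntegral.integral_congr fun t _ => ?_))
  · push_cast
    ring_nf
  · rw [mul_left_comm, ← Complex.exp_add]
    ring_nf

theorem expIntegral_neg_I_mul (σ : ℝ) :
    expIntegral a b (-(Complex.I * σ)) f =
      (starRingEnd ℂ) (expIntegral a b (Complex.I * σ) f) := by
  simp [expIntegral, ← intervalIntegral.intervalIntegral_conj, ← Complex.exp_conj]

end ExpIntegral

/-- The complex frequencies `j(σ + 2πk/L)`, `k ∈ ℤ`, of the functions `f` that satisfy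
`f (t + L) = e^{jσL} f t`; `σ = 0` gives the periodic and `σ = π/L` the antiperiodic ones. -/
noncomputable def quasiFreq (σ L : ℝ) (k : ℤ) : ℂ :=
  Complex.I * (σ + 2 * Real.pi * k / L : ℝ)

section QuasiFreq

variable {a b σ : ℝ}

theorem mul_cexp_neg_quasiFreq_eq (hab : a < b) {z w : ℂ}
    (h : w = Complex.exp (Complex.I * σ * (b - a)) * z) (k : ℤ) :
    w * Complex.exp (-(quasiFreq σ (b - a) k * b)) =
      z * Complex.exp (-(quasiFreq σ (b - a) k * a)) := by
  have hba : (b : ℂ) - a ≠ 0 := by exact_mod_cast (sub_pos.2 hab).ne'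
  have hexp : Complex.exp (-(quasiFreq σ (b - a) k * a)) =
      Complex.exp (Complex.I * σ * (b - a) + -(quasiFreq σ (b - a) k * b)) := by
    refine Complex.exp_eq_exp_iff_exists_int.2 ⟨k, ?_⟩
    simp only [quasiFreq]
    push_cast
    field_simp
    ring
  rw [hexp, Complex.exp_add, h]
  ring

variable {f f' : ℝ → ℝ}

theorem mul_fourierCoeffOn_mul_cexp (hab : a < b) (k : ℤ) :
    (b - a) * fourierCoeffOn hab (fun t => (f t : ℂ) * Complex.exp (-(Complex.I * σ * t))) k =
      expIntegral a b (quasiFreq σ (b - a) k) f := by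
  have hba : (b : ℂ) - a ≠ 0 := by exact_mod_cast (sub_pos.2 hab).ne'
  rw [fourierCoeffOn_eq_integral, Complex.real_smul]
  push_cast
  rw [← mul_assoc, mul_one_div_cancel hba, one_mul]
  refine intervalIntegral.integral_congr fun t _ => ?_
  simp only [fourier_coe_apply, smul_eq_mul, mul_left_comm _ (f t : ℂ), ← Complex.exp_add,
    quasiFreq]
  push_cast
  ring_nf

theorem hasSum_expIntegral_mul_cexp (hab : a < b) (hf : ContinuousOn f (Icc a b))
    (hd : ∀ t ∈ Ioo a b, HasDerivAt f (f' t) t) (hf' : ContinuousOn f' (Icc a b))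
    (h : (f b : ℂ) = Complex.exp (Complex.I * σ * (b - a)) * f a) {x : ℝ} (hx : x ∈ Icc a b) :
    HasSum (fun k : ℤ => expIntegral a b (quasiFreq σ (b - a) k) f *
      Complex.exp (quasiFreq σ (b - a) k * x)) ((b - a) * f x) := by
  have hfc := Complex.continuous_ofReal.comp_continuousOn hf
  have hend : f a * Complex.exp (-(Complex.I * σ * a)) =
      f b * Complex.exp (-(Complex.I * σ * b)) := by
    simpa [quasiFreq] using (mul_cexp_neg_quasiFreq_eq hab h 0).symm
  have hseries := (hasSum_fourierCoeffOn_mul_fourier hab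
    (f := fun t => (f t : ℂ) * Complex.exp (-(Complex.I * σ * t)))
    (hfc.mul (by fun_prop))
    (fun t ht => (hd t ht).ofReal_comp.mul (hasDerivAt_cexp_neg_mul _ t))
    (((Complex.continuous_ofReal.comp_continuousOn hf').mul (by fun_prop)).add
      (hfc.mul (by fun_prop))) hend hx).mul_left ((b - a) * Complex.exp (Complex.I * σ * x))
  have hval : (b - a) * Complex.exp (Complex.I * σ * x) *
      (f x * Complex.exp (-(Complex.I * σ * x))) = (b - a) * f x := by
    rw [mul_mul_mul_comm, ← Complex.exp_add, add_neg_cancel, Complex.exp_zero, mul_one]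
  rw [hval] at hseries
  refine hseries.congr_fun fun k => ?_
  have hexp : Complex.exp (quasiFreq σ (b - a) k * x) = Complex.exp (Complex.I * σ * x) *
      fourier k (x : AddCircle (b - a)) := by
    rw [fourier_coe_apply, quasiFreq, ← Complex.exp_add]
    push_cast
    ring_nf
  rw [← mul_fourierCoeffOn_mul_cexp hab, hexp]
  ring

end QuasiFreq

/-! ### Linear flows between resets -/

section LinearFlow

variable {ι : Type*} [Fintype ι]

theorem hasDerivAt_dotProduct (c : ι → ℝ) {X : ℝ → ι → ℝ} {X' : ι → ℝ} {t : ℝ}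
    (hX : HasDerivAt X X' t) : HasDerivAt (fun t => c ⬝ᵥ X t) (c ⬝ᵥ X') t :=
  HasDerivAt.fun_sum fun i _ => (hasDerivAt_pi.1 hX i).const_mul (c i)

theorem continuousOn_dotProduct (c : ι → ℝ) {X : ℝ → ι → ℝ} {s : Set ℝ}
    (hX : ContinuousOn X s) : ContinuousOn (fun t => c ⬝ᵥ X t) s :=
  (continuous_const.dotProduct continuous_id).comp_continuousOn hX

theorem continuousOn_mulVec (A : Matrix ι ι ℝ) {X : ℝ → ι → ℝ} {s : Set ℝ}
    (hX : ContinuousOn X s) : ContinuousOn (fun t => A *ᵥ X t) s :=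
  (continuous_const.matrix_mulVec continuous_id).comp_continuousOn hX

variable [DecidableEq ι]

theorem eq_inv_mulVec_of_mulVec_eq {M : Matrix ι ι ℂ} (hM : M.det ≠ 0) {v w : ι → ℂ}
    (h : M *ᵥ v = w) : v = M⁻¹ *ᵥ w := by
  rw [← h, Matrix.mulVec_mulVec, Matrix.nonsing_inv_mul _ (isUnit_iff_ne_zero.2 hM),
    Matrix.one_mulVec]

/-- The complex matrix `sI - A` of a real matrix `A`, which the transforms of solutions of
`X' = A X + w` are multiplied by. -/
def pencil (A : Matrix ι ι ℝ) (s : ℂ) : Matrix ι ι ℂ :=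
  s • (1 : Matrix ι ι ℂ) - A.map Complex.ofReal

/-- The transfer function `c (sI - A)⁻¹ e` from the input column `e` to the output row `c`. -/
noncomputable def transferFn (A : Matrix ι ι ℝ) (e c : ι → ℝ) (s : ℂ) : ℂ :=
  (fun i => (c i : ℂ)) ⬝ᵥ ((pencil A s)⁻¹ *ᵥ fun i => (e i : ℂ))

theorem HurwitzMatrix.det_pencil_ne_zero {ι : Type} [Fintype ι] [DecidableEq ι]
    {A : Matrix ι ι ℝ} (hA : HurwitzMatrix A) {s : ℂ} (hs : 0 ≤ s.re) :
    (pencil A s).det ≠ 0 := by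
  intro h
  refine (hA s ?_).not_ge hs
  rw [spectrum.mem_iff, Matrix.isUnit_iff_isUnit_det, Algebra.algebraMap_eq_smul_one]
  change ¬IsUnit (pencil A s).det
  simp [h]

variable {A : Matrix ι ι ℝ} {a b : ℝ} {X w : ℝ → ι → ℝ}

theorem pencil_mulVec_expIntegral (hab : a ≤ b) (hX : ContinuousOn X (Icc a b))
    (hw : ContinuousOn w (Icc a b)) (hd : ∀ t ∈ Ioo a b, HasDerivAt X (A *ᵥ X t + w t) t)
    (s : ℂ) :
    pencil A s *ᵥ (fun i => expIntegral a b s (fun t => X t i)) = fun i =>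
      expIntegral a b s (fun t => w t i) + X a i * Complex.exp (-(s * a)) -
        X b i * Complex.exp (-(s * b)) := by
  ext i
  have hXi : ∀ i, IntervalIntegrable (fun t => X t i) volume a b := fun i =>
    (continuousOn_pi.1 hX i).intervalIntegrable_of_Icc hab
  have hAX := continuousOn_dotProduct (A i) hX
  have hwi := continuousOn_pi.1 hw i
  have hparts := expIntegral_deriv (s := s) hab (continuousOn_pi.1 hX i)
    (f' := fun t => A i ⬝ᵥ X t + w t i) (fun t ht => hasDerivAt_pi.1 (hd t ht) i) (hAX.add hwi)
  rw [expIntegral_add (hAX.intervalIntegrable_of_Icc hab) (hwi.intervalIntegrable_of_Icc hab),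
    expIntegral_dotProduct _ hXi] at hparts
  rw [pencil, Matrix.sub_mulVec, Matrix.smul_mulVec, Matrix.one_mulVec, Pi.sub_apply,
    Pi.smul_apply, smul_eq_mul, Matrix.mulVec]
  simp only [Matrix.map_apply]
  linear_combination -hparts

/-- All Fourier coefficients of a quasiperiodic free response vanish when none of its frequencies
is a characteristic one. -/
theorem eq_zero_of_quasiperiodic (hab : a < b) (hX : ContinuousOn X (Icc a b))
    (hd : ∀ t ∈ Ioo a b, HasDerivAt X (A *ᵥ X t) t) {σ : ℝ}
    (h : ∀ i, (X b i : ℂ) = Complex.exp (Complex.I * σ * (b - a)) * X a i)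
    (hdet : ∀ k : ℤ, (pencil A (quasiFreq σ (b - a) k)).det ≠ 0) {t : ℝ} (ht : t ∈ Icc a b) :
    X t = 0 := by
  have hcoeff : ∀ (k : ℤ) i,
      expIntegral a b (quasiFreq σ (b - a) k) (fun t => X t i) = 0 := by
    intro k
    refine congrFun (Matrix.eq_zero_of_mulVec_eq_zero (hdet k) ?_)
    rw [pencil_mulVec_expIntegral (w := 0) hab.le hX continuousOn_const (by simpa using hd)]
    ext i
    simp [mul_cexp_neg_quasiFreq_eq hab (h i)]
  ext i
  have hsum := hasSum_expIntegral_mul_cexp hab (continuousOn_pi.1 hX i)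
    (fun t ht => hasDerivAt_pi.1 (hd t ht) i)
    (continuousOn_pi.1 (continuousOn_mulVec A hX) i) (h i) ht
  simp only [hcoeff, zero_mul] at hsum
  have hba : (b : ℂ) - a ≠ 0 := by exact_mod_cast (sub_pos.2 hab).ne'
  exact_mod_cast (mul_eq_zero.1 (hsum.unique hasSum_zero)).resolve_left hba

theorem hasDerivAt_exp_sub_smul_mulVec (A : Matrix ι ι ℝ) (v : ι → ℝ) (a t : ℝ) :
    HasDerivAt (fun t : ℝ => NormedSpace.exp ((t - a) • A) *ᵥ v)
      (A *ᵥ (NormedSpace.exp ((t - a) • A) *ᵥ v)) t := by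
  let _ : NormedRing (Matrix ι ι ℝ) := Matrix.linftyOpNormedRing
  let _ : NormedAlgebra ℝ (Matrix ι ι ℝ) := Matrix.linftyOpNormedAlgebra
  have hexp := (hasDerivAt_exp_smul_const' (𝕂 := ℝ) A (t - a)).comp_sub_const t a
  rw [Matrix.mulVec_mulVec]
  exact (LinearMap.toContinuousLinearMap
    ((Matrix.mulVecBilin ℝ ℝ).flip v : Matrix ι ι ℝ →ₗ[ℝ] (ι → ℝ))).hasFDerivAt.comp_hasDerivAt
    t hexp

theorem exp_sub_self_smul_mulVec (A : Matrix ι ι ℝ) (v : ι → ℝ) (a : ℝ) :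
    NormedSpace.exp ((a - a) • A) *ᵥ v = v := by
  rw [sub_self, zero_smul, NormedSpace.exp_zero, Matrix.one_mulVec]

theorem cexp_I_mul_mul_pi_div {ω : ℝ} (hω : ω ≠ 0) :
    Complex.exp (Complex.I * ω * (Real.pi / ω)) = -1 := by
  have hω' : (ω : ℂ) ≠ 0 := Complex.ofReal_ne_zero.2 hω
  rw [mul_assoc, mul_div_cancel₀ _ hω', mul_comm, Complex.exp_pi_mul_I]

/-- An eigenvector of `e^{Aπ/ω}` for the eigenvalue `-1` starts an antiperiodic free response. -/
theorem det_one_add_exp_ne_zero (A : Matrix ι ι ℝ) {ω : ℝ} (hω : 0 < ω)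
    (hdet : ∀ k : ℤ, (pencil A (quasiFreq ω (Real.pi / ω) k)).det ≠ 0) :
    (1 + NormedSpace.exp ((Real.pi / ω) • A)).det ≠ 0 := by
  intro h
  obtain ⟨v, hv, hv0⟩ := Matrix.exists_mulVec_eq_zero_iff.2 h
  have hd := hasDerivAt_exp_sub_smul_mulVec A v 0
  have hpos : 0 < Real.pi / ω := div_pos Real.pi_pos hω
  have hstart := exp_sub_self_smul_mulVec A v 0
  rw [Matrix.add_mulVec, Matrix.one_mulVec, add_eq_zero_iff_eq_neg'] at hv0
  refine hv (hstart.symm.trans (eq_zero_of_quasiperiodic (σ := ω) hpos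
    (fun t _ => (hd t).continuousAt.continuousWithinAt) (fun t _ => hd t) (fun i => ?_)
    (by simpa only [sub_zero] using hdet) (left_mem_Icc.2 hpos.le)))
  have hphase := cexp_I_mul_mul_pi_div hω.ne'
  rw [hstart, sub_zero, hv0]
  push_cast
  rw [sub_zero, hphase]
  simp

end LinearFlow

/-! ### Periodic responses reset once per period -/

section PassiveReset

variable {ι : Type*} [Fintype ι] [DecidableEq ι] {A : Matrix ι ι ℝ} {a b : ℝ} {X : ℝ → ι → ℝ}

/-- At an end point the Fourier series converges to the mean of the two boundary values: apply the
expansion to the continuous periodic function `f(t) + f(a + b - t)`. -/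
theorem hasSum_re_expIntegral_mul_cexp (hab : a < b) {f f' : ℝ → ℝ}
    (hf : ContinuousOn f (Icc a b)) (hd : ∀ t ∈ Ioo a b, HasDerivAt f (f' t) t)
    (hf' : ContinuousOn f' (Icc a b)) :
    HasSum (fun k : ℤ => 2 * (expIntegral a b (quasiFreq 0 (b - a) k) f *
      Complex.exp (quasiFreq 0 (b - a) k * a)).re) ((b - a) * (f a + f b)) := by
  have hmaps : MapsTo (fun t => a + b - t) (Icc a b) (Icc a b) := fun t ht =>
    ⟨by linarith [ht.2], by linarith [ht.1]⟩
  have hfr : ContinuousOn (fun t => f (a + b - t)) (Icc a b) := hf.comp (by fun_prop) hmaps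
  have hdsym : ∀ t ∈ Ioo a b,
      HasDerivAt (fun t => f t + f (a + b - t)) (f' t + -f' (a + b - t)) t := fun t ht =>
    (hd t ht).add ((hd _ ⟨by linarith [ht.2], by linarith [ht.1]⟩).comp_const_sub (a + b) t)
  have hsum := hasSum_expIntegral_mul_cexp (σ := 0) (f := fun t => f t + f (a + b - t)) hab
    (hf.add hfr) hdsym (hf'.add (hf'.comp (by fun_prop) hmaps).neg) (by simp [add_comm])
    (left_mem_Icc.2 hab.le)
  have hre := Complex.hasSum_re hsum
  simp only [add_sub_cancel_left] at hre
  rw [← Complex.ofReal_sub, ← Complex.ofReal_mul, Complex.ofReal_re] at hre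
  refine hre.congr_fun fun k => ?_
  set s := quasiFreq 0 (b - a) k with hs
  have hper : Complex.exp (-(s * b)) = Complex.exp (-(s * a)) := by
    simpa using mul_cexp_neg_quasiFreq_eq hab (z := 1) (w := 1) (σ := 0) (by simp) k
  have hreflect : Complex.exp (-(s * (a + b : ℝ))) * expIntegral a b (-s) f *
      Complex.exp (s * a) = (starRingEnd ℂ) (expIntegral a b s f * Complex.exp (s * a)) := by
    have hconj : (starRingEnd ℂ) (Complex.exp (s * a)) = Complex.exp (-(s * a)) := by
      rw [← Complex.exp_conj, hs, quasiFreq]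
      simp only [map_mul, Complex.conj_I, Complex.conj_ofReal, neg_mul]
    have hexp : Complex.exp (-(s * (a + b : ℝ))) * Complex.exp (s * a) =
        Complex.exp (-(s * a)) := by
      rw [← hper, ← Complex.exp_add]
      push_cast
      ring_nf
    rw [map_mul, hconj, ← hexp, hs, quasiFreq, expIntegral_neg_I_mul]
    ring
  rw [expIntegral_add (hf.intervalIntegrable_of_Icc hab.le) (hfr.intervalIntegrable_of_Icc hab.le),
    expIntegral_reflect, add_mul, hreflect, Complex.add_re, Complex.conj_re, two_mul]

variable {g : ℝ} {e : ι → ℝ}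

theorem expIntegral_dotProduct_mul_cexp_of_jump (hab : a < b) (c : ι → ℝ)
    (hX : ContinuousOn X (Icc a b)) (hd : ∀ t ∈ Ioo a b, HasDerivAt X (A *ᵥ X t) t)
    (hjump : X a = X b + g • e) {k : ℤ} (hdet : (pencil A (quasiFreq 0 (b - a) k)).det ≠ 0) :
    expIntegral a b (quasiFreq 0 (b - a) k) (fun t => c ⬝ᵥ X t) *
      Complex.exp (quasiFreq 0 (b - a) k * a) = g * transferFn A e c (quasiFreq 0 (b - a) k) := by
  have hper := mul_cexp_neg_quasiFreq_eq hab (z := 1) (w := 1) (σ := 0) (by simp) k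
  set s := quasiFreq 0 (b - a) k
  have htransform : pencil A s *ᵥ (fun i => expIntegral a b s (fun t => X t i)) =
      (g * Complex.exp (-(s * a))) • fun i => (e i : ℂ) := by
    rw [pencil_mulVec_expIntegral (w := 0) hab.le hX continuousOn_const (by simpa using hd)]
    ext i
    simp only [Pi.zero_apply, expIntegral_zero, hjump, Pi.add_apply, Pi.smul_apply, smul_eq_mul]
    push_cast
    linear_combination -(X b i : ℂ) * hper
  rw [expIntegral_dotProduct c fun i =>
      (continuousOn_pi.1 hX i).intervalIntegrable_of_Icc hab.le,
    eq_inv_mulVec_of_mulVec_eq hdet htransform, Matrix.mulVec_smul, dotProduct_smul, smul_eq_mul,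
    mul_right_comm, mul_assoc (g : ℂ), ← Complex.exp_add, neg_add_cancel, Complex.exp_zero,
    mul_one, transferFn]

theorem jump_mul_boundary_sum_nonneg (hab : a < b) (c : ι → ℝ) (hX : ContinuousOn X (Icc a b))
    (hd : ∀ t ∈ Ioo a b, HasDerivAt X (A *ᵥ X t) t) (hjump : X a = X b + g • e)
    (hdet : ∀ k : ℤ, (pencil A (quasiFreq 0 (b - a) k)).det ≠ 0)
    (hpos : ∀ k : ℤ, 0 ≤ (transferFn A e c (quasiFreq 0 (b - a) k)).re) :
    0 ≤ g * (c ⬝ᵥ X a + c ⬝ᵥ X b) := by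
  have hsum := (hasSum_re_expIntegral_mul_cexp hab (continuousOn_dotProduct c hX)
    (fun t ht => hasDerivAt_dotProduct c (hd t ht))
    (continuousOn_dotProduct c (continuousOn_mulVec A hX))).mul_left g
  have hnn : 0 ≤ g * ((b - a) * (c ⬝ᵥ X a + c ⬝ᵥ X b)) := hsum.nonneg fun k => by
    rw [expIntegral_dotProduct_mul_cexp_of_jump hab c hX hd hjump (hdet k),
      Complex.re_ofReal_mul, mul_left_comm, ← mul_assoc g, ← sq]
    exact mul_nonneg zero_le_two (mul_nonneg (sq_nonneg g) (hpos k))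
  rw [mul_left_comm] at hnn
  exact nonneg_of_mul_nonneg_right hnn (sub_pos.2 hab)

/-- The jump would supply the passive channel with the energy `-p (1 - γ²) (X b q)² ≤ 0`. -/
theorem eq_zero_of_passive_reset (hab : a < b) {c : ι → ℝ} {q : ι} {β p γ : ℝ}
    (hp : 0 < p) (hγ : γ ∈ Ioc (-1 : ℝ) 1)
    (hdet : ∀ k : ℤ, (pencil A (quasiFreq 0 (b - a) k)).det ≠ 0)
    (hpos : ∀ k : ℤ, 0 ≤ (transferFn A (Pi.single q 1) (β • c + p • Pi.single q 1)
      (quasiFreq 0 (b - a) k)).re)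
    (hX : ContinuousOn X (Icc a b)) (hd : ∀ t ∈ Ioo a b, HasDerivAt X (A *ᵥ X t) t)
    (hjump : X a = X b + ((γ - 1) * X b q) • Pi.single q 1)
    (hcq : c q = 0) (hcb : c ⬝ᵥ X b = 0) {t : ℝ} (ht : t ∈ Icc a b) : X t = 0 := by
  have hb : (β • c + p • Pi.single q 1) ⬝ᵥ X b = p * X b q := by simp [hcb]
  have ha : (β • c + p • Pi.single q 1) ⬝ᵥ X a = p * (γ * X b q) := by
    rw [hjump, dotProduct_add, hb]
    simp [hcq]
    ring
  have henergy : 0 ≤ -(p * (1 - γ) * (1 + γ) * X b q ^ 2) := by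
    convert jump_mul_boundary_sum_nonneg hab _ hX hd hjump hdet hpos using 1
    rw [ha, hb]
    ring
  have hg : (γ - 1) * X b q = 0 := by
    rcases hγ.2.eq_or_lt with rfl | hlt
    · rw [sub_self, zero_mul]
    · have hcoef : 0 < p * (1 - γ) * (1 + γ) :=
        mul_pos (mul_pos hp (sub_pos.2 hlt)) (by linarith [hγ.1])
      have hsq : X b q ^ 2 = 0 := by nlinarith [sq_nonneg (X b q)]
      rw [pow_eq_zero_iff two_ne_zero |>.1 hsq, mul_zero]
  refine eq_zero_of_quasiperiodic (σ := 0) hab hX hd (fun i => ?_) hdet ht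
  rw [hjump, hg]
  simp

end PassiveReset

/-! ### Phasors -/

section Phasor

variable {ω : ℝ} {n : ℕ} {f g : ℝ → ℝ}

theorem cexp_neg_jw_mul_pi_div (hω : ω ≠ 0) (n : ℕ) :
    Complex.exp (-(jw ω n * (Real.pi / ω : ℝ))) = (-1) ^ n := by
  have hexp : -(jw ω n * (Real.pi / ω : ℝ)) = (n : ℂ) * -(Complex.I * ω * (Real.pi / ω)) := by
    simp only [jw]
    push_cast
    ring
  rw [hexp, Complex.exp_nat_mul, Complex.exp_neg, cexp_I_mul_mul_pi_div hω]
  norm_num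

theorem cexp_neg_jw_mul_add_pi_div (hω : ω ≠ 0) (hn : Odd n) (a : ℝ) :
    Complex.exp (-(jw ω n * (a + Real.pi / ω : ℝ))) = -Complex.exp (-(jw ω n * a)) := by
  rw [Complex.ofReal_add, mul_add, neg_add, Complex.exp_add, cexp_neg_jw_mul_pi_div hω,
    hn.neg_one_pow, mul_neg_one]

theorem expIntegral_comp_add_right (a b : ℝ) (s : ℂ) (f : ℝ → ℝ) (h : ℝ) :
    expIntegral (a + h) (b + h) s f =
      Complex.exp (-(s * h)) * expIntegral a b s (fun t => f (t + h)) := by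
  rw [expIntegral, ← intervalIntegral.integral_comp_add_right, expIntegral,
    ← intervalIntegral.integral_const_mul]
  refine intervalIntegral.integral_congr fun t _ => ?_
  rw [mul_left_comm, ← Complex.exp_add]
  push_cast
  ring_nf

theorem expIntegral_neg (a b : ℝ) (s : ℂ) (f : ℝ → ℝ) :
    expIntegral a b s (fun t => -f t) = -expIntegral a b s f := by
  simp only [expIntegral, Complex.ofReal_neg, neg_mul, intervalIntegral.integral_neg]

theorem phasor_eq (ω : ℝ) (n : ℕ) (f : ℝ → ℝ) :
    phasor ω n f = 2 * Complex.I * (ω / (2 * Real.pi) : ℝ) *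
      expIntegral 0 (2 * Real.pi / ω) (jw ω n) f := by
  simp only [phasor, expIntegral, jw, Complex.ofReal_mul, mul_assoc]

theorem phasor_add (hf : IntervalIntegrable f volume 0 (2 * Real.pi / ω))
    (hg : IntervalIntegrable g volume 0 (2 * Real.pi / ω)) :
    phasor ω n (fun t => f t + g t) = phasor ω n f + phasor ω n g := by
  simp only [phasor_eq, expIntegral_add hf hg, mul_add]

theorem phasor_const_mul (c : ℝ) : phasor ω n (fun t => c * f t) = c * phasor ω n f := by
  simp only [phasor_eq, expIntegral_const_mul]
  ring

theorem phasor_dotProduct {ι : Type*} [Fintype ι] (c : ι → ℝ) {X : ℝ → ι → ℝ}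
    (hX : ∀ i, IntervalIntegrable (fun t => X t i) volume 0 (2 * Real.pi / ω)) :
    phasor ω n (fun t => c ⬝ᵥ X t) =
      (fun i => (c i : ℂ)) ⬝ᵥ fun i => phasor ω n (fun t => X t i) := by
  simp only [phasor_eq, expIntegral_dotProduct c hX]
  rw [← smul_eq_mul, ← dotProduct_smul]
  rfl

theorem intervalIntegrable_of_antiperiodic {h a : ℝ} (hf : Function.Antiperiodic f h)
    (hh : 0 < h) (hint : IntervalIntegrable f volume a (a + h)) (b c : ℝ) :
    IntervalIntegrable f volume b c := by
  have hnext : IntervalIntegrable f volume (a + h) (a + 2 * h) := by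
    have hshift := (hint.neg.comp_sub_right h).congr (g := f) fun t _ => by
      simp [← hf (t - h)]
    rwa [add_assoc, ← two_mul] at hshift
  exact hf.periodic_two_mul.intervalIntegrable (by positivity) (hint.trans hnext) b c

theorem phasor_of_antiperiodic (hω : 0 < ω) (hf : Function.Antiperiodic f (Real.pi / ω)) {a : ℝ}
    (hint : IntervalIntegrable f volume a (a + Real.pi / ω)) (n : ℕ) :
    phasor ω n f =
      (1 - (-1) ^ n) * Complex.I * (ω / Real.pi) * expIntegral a (a + Real.pi / ω) (jw ω n) f := by
  set h := Real.pi / ω with hh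
  have hpos : 0 < h := div_pos Real.pi_pos hω
  have hperiod : 2 * Real.pi / ω = 2 * h := by rw [hh, mul_div_assoc]
  have hfi := fun b c => intervalIntegrable_mul_cexp
    (intervalIntegrable_of_antiperiodic hf hpos hint b c) (jw ω n)
  have hcexp : Complex.exp (-(jw ω n * h)) = (-1) ^ n := cexp_neg_jw_mul_pi_div hω.ne' n
  have hshift := expIntegral_comp_add_right a (a + h) (jw ω n) f h
  simp only [hf _, expIntegral_neg, hcexp] at hshift
  have hper : Function.Periodic
      (fun t : ℝ => (f t : ℂ) * Complex.exp (-(jw ω n * t))) (2 * h) := by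
    intro t
    have hexp : Complex.exp (-(jw ω n * (t + 2 * h : ℝ))) = Complex.exp (-(jw ω n * t)) := by
      have hsplit : -(jw ω n * (t + 2 * h : ℝ)) = -(jw ω n * t) + 2 * -(jw ω n * h) := by
        push_cast
        ring
      rw [hsplit, Complex.exp_add, two_mul, Complex.exp_add, hcexp, ← mul_pow]
      norm_num
    simp only [hf.periodic_two_mul t, hexp]
  have hcycle : expIntegral 0 (2 * h) (jw ω n) f =
      expIntegral a (a + h) (jw ω n) f + expIntegral (a + h) (a + h + h) (jw ω n) f := by
    rw [expIntegral, expIntegral, expIntegral,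
      intervalIntegral.integral_add_adjacent_intervals (hfi _ _) (hfi _ _)]
    simpa only [zero_add, add_assoc, two_mul] using hper.intervalIntegral_add_eq 0 a
  rw [phasor_eq, hperiod, hcycle, hshift]
  push_cast
  field_simp
  ring

theorem phasor_of_antiperiodic_of_odd (hω : 0 < ω) (hf : Function.Antiperiodic f (Real.pi / ω))
    {a : ℝ} (hint : IntervalIntegrable f volume a (a + Real.pi / ω)) (hn : Odd n) :
    phasor ω n f =
      2 * Complex.I * (ω / Real.pi) * expIntegral a (a + Real.pi / ω) (jw ω n) f := by
  rw [phasor_of_antiperiodic hω hf hint, hn.neg_one_pow]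
  norm_num

theorem phasor_of_antiperiodic_of_even (hω : 0 < ω) (hf : Function.Antiperiodic f (Real.pi / ω))
    {a : ℝ} (hint : IntervalIntegrable f volume a (a + Real.pi / ω)) (hn : Even n) :
    phasor ω n f = 0 := by
  rw [phasor_of_antiperiodic hω hf hint, hn.neg_one_pow]
  simp

theorem integral_cexp_int_mul (hω : ω ≠ 0) (k : ℤ) :
    ∫ t in (0 : ℝ)..(2 * Real.pi / ω), Complex.exp (Complex.I * (k * ω) * t) =
      if k = 0 then 2 * Real.pi / ω else 0 := by
  have hω' : (ω : ℂ) ≠ 0 := Complex.ofReal_ne_zero.2 hω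
  split_ifs with hk
  · simp [hk]
  · have hfreq : Complex.I * (k * ω) ≠ 0 :=
      mul_ne_zero Complex.I_ne_zero (mul_ne_zero (Int.cast_ne_zero.2 hk) hω')
    have hcycle : Complex.I * (k * ω) * (2 * Real.pi / ω : ℝ) =
        (k : ℂ) * (2 * Real.pi * Complex.I) := by
      push_cast
      field_simp
    rw [integral_exp_mul_complex hfreq, hcycle, Complex.exp_int_mul_two_pi_mul_I]
    simp

theorem sin_mul_cexp_neg_jw_mul (ω : ℝ) (m n : ℕ) (t : ℝ) :
    (Real.sin (m * ω * t) : ℂ) * Complex.exp (-(jw ω n * t)) =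
      (Complex.exp (Complex.I * (((m - n : ℤ) : ℂ) * ω) * t) -
        Complex.exp (Complex.I * (((-(m + n) : ℤ) : ℂ) * ω) * t)) / (2 * Complex.I) := by
  have hplus : Complex.I * (((m - n : ℤ) : ℂ) * ω) * t =
      (m * ω * t : ℂ) * Complex.I + -(jw ω n * t) := by
    simp only [jw]
    push_cast
    ring
  have hminus : Complex.I * (((-(m + n) : ℤ) : ℂ) * ω) * t =
      -(m * ω * t : ℂ) * Complex.I + -(jw ω n * t) := by
    simp only [jw]
    push_cast
    ring
  rw [hplus, hminus, Complex.exp_add, Complex.exp_add, Complex.ofReal_sin, Complex.sin]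
  push_cast
  field_simp
  linear_combination (Complex.exp (-(m * ω * t * Complex.I)) -
    Complex.exp (m * ω * t * Complex.I)) * Complex.I_sq

theorem phasor_sin (hω : ω ≠ 0) (R : ℝ) {m : ℕ} (hm : m ≠ 0) (n : ℕ) :
    phasor ω n (fun t => R * Real.sin (m * ω * t)) = if n = m then (R : ℂ) else 0 := by
  have hω' : (ω : ℂ) ≠ 0 := Complex.ofReal_ne_zero.2 hω
  have hπ : (Real.pi : ℂ) ≠ 0 := Complex.ofReal_ne_zero.2 Real.pi_ne_zero
  rw [phasor_const_mul, phasor_eq, expIntegral]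
  simp only [sin_mul_cexp_neg_jw_mul]
  rw [intervalIntegral.integral_div, intervalIntegral.integral_sub
      (Continuous.intervalIntegrable (by fun_prop) _ _)
      (Continuous.intervalIntegrable (by fun_prop) _ _),
    integral_cexp_int_mul hω, integral_cexp_int_mul hω, if_neg (by omega : ¬ -((m : ℤ) + n) = 0)]
  rcases eq_or_ne n m with rfl | hnm
  · rw [if_pos (sub_self _), if_pos rfl]
    push_cast
    field_simp
    ring
  · rw [if_neg (by omega), if_neg hnm]
    simp

theorem hosidf_eq (hω : ω ≠ 0) (R : ℝ) (f : ℝ → ℝ) (hn : n ≠ 0) :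
    hosidf ω R f n = phasor ω n f / R := by
  rw [hosidf, phasor_sin hω R hn, if_pos rfl]

end Phasor

/-! ### The algebra of the block diagram -/

namespace ResetLoop

section BlockDiagram

variable (S : ResetLoop)

/-- There is no direct feedthrough around the loop. -/
def NoFeedthrough : Prop :=
  (S.sys Block.C1).D * (S.sys Block.C3).D * (S.sys Block.P).D * (S.sys Block.C4).D = 0

/-- Contribution of the state of block `b` to its output. -/
def stateOut (x : S.Idx → ℝ) (b : Block) : ℝ := (S.sys b).C ⬝ᵥ fun i => x ⟨b, i⟩

/-- The output of `C1` as a function of the state and the reference. It is found by going round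
the loop once; the feedthrough from `C3` back to itself is dropped, see `NoFeedthrough`. -/
def solveZ (x : S.Idx → ℝ) (r : ℝ) : ℝ :=
  S.stateOut x Block.C1 + (S.sys Block.C1).D * (r - S.stateOut x Block.C4 -
    (S.sys Block.C4).D * (S.stateOut x Block.P + (S.sys Block.P).D * S.stateOut x Block.C3))

/-- The input of `C3` as a function of the state and the reference. -/
def solveV (x : S.Idx → ℝ) (r : ℝ) : ℝ :=
  S.stateOut x Block.Cr + (S.sys Block.Cr).D * S.solveZ x r +
    (S.stateOut x Block.C2 + (S.sys Block.C2).D * S.solveZ x r)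

/-- The control input as a function of the state and the reference. -/
def solveU (x : S.Idx → ℝ) (r : ℝ) : ℝ :=
  S.stateOut x Block.C3 + (S.sys Block.C3).D * S.solveV x r

/-- The plant output as a function of the state and the reference. -/
def solveY (x : S.Idx → ℝ) (r : ℝ) : ℝ :=
  S.stateOut x Block.P + (S.sys Block.P).D * S.solveU x r

/-- The block inputs that solve the block diagram when there is no direct feedthrough around the
loop. -/
def solve (x : S.Idx → ℝ) (r : ℝ) : Block → ℝ
  | Block.Cr => S.solveZ x r
  | Block.C1 => r - (S.stateOut x Block.C4 + (S.sys Block.C4).D * S.solveY x r)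
  | Block.C2 => S.solveZ x r
  | Block.C3 => S.solveV x r
  | Block.C4 => S.solveY x r
  | Block.Cs => S.solveZ x r
  | Block.P => S.solveU x r

variable {S} {x y : S.Idx → ℝ} {r s : ℝ} {i j : Block → ℝ}

theorem Diagram.eq_solve (hS : S.NoFeedthrough) (h : S.Diagram x r i) : i = S.solve x r := by
  obtain ⟨he, hzr, hz2, hzs, hv, hu, hy⟩ := h
  have hout : ∀ b, S.out x i b = S.stateOut x b + (S.sys b).D * i b := fun _ => rfl
  simp only [hout] at he hzr hz2 hzs hv hu hy
  have hz : S.stateOut x Block.C1 + (S.sys Block.C1).D * i Block.C1 = S.solveZ x r := by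
    rw [NoFeedthrough] at hS
    rw [solveZ]
    linear_combination (S.sys Block.C1).D * he - (S.sys Block.C1).D * (S.sys Block.C4).D * hy -
      (S.sys Block.C1).D * (S.sys Block.C4).D * (S.sys Block.P).D * hu - i Block.C3 * hS
  rw [hz] at hzr hz2 hzs
  have hv' : i Block.C3 = S.solveV x r := by rw [hv, hzr, hz2]; rfl
  have hu' : i Block.P = S.solveU x r := by rw [hu, hv']; rfl
  have hy' : i Block.C4 = S.solveY x r := by rw [hy, hu']; rfl
  have he' : i Block.C1 = S.solve x r Block.C1 := by rw [he, hy']; rfl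
  ext b
  cases b
  exacts [hzr, he', hz2, hv', hy', hzs, hu']

theorem diagram_solve (hS : S.NoFeedthrough) (x : S.Idx → ℝ) (r : ℝ) :
    S.Diagram x r (S.solve x r) := by
  have hz : S.solveZ x r = S.out x (S.solve x r) Block.C1 := by
    change _ = S.stateOut x Block.C1 + (S.sys Block.C1).D *
      (r - (S.stateOut x Block.C4 + (S.sys Block.C4).D * (S.stateOut x Block.P +
        (S.sys Block.P).D * (S.stateOut x Block.C3 + (S.sys Block.C3).D * S.solveV x r))))
    rw [NoFeedthrough] at hS
    rw [solveZ]
    linear_combination S.solveV x r * hS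
  exact ⟨rfl, hz, hz, hz, rfl, rfl, rfl⟩

theorem Diagram.eq_zero (hS : S.NoFeedthrough) (h : S.Diagram 0 0 i) : i = 0 := by
  have hstate : ∀ b, S.stateOut 0 b = 0 := fun b => dotProduct_zero (S.sys b).C
  rw [h.eq_solve hS]
  ext b
  cases b <;> simp [solve, solveZ, solveV, solveU, solveY, hstate]

theorem out_add (x y : S.Idx → ℝ) (i j : Block → ℝ) (b : Block) :
    S.out (x + y) (i + j) b = S.out x i b + S.out y j b := by
  have hstate : (fun k => (x + y) ⟨b, k⟩) = (fun k => x ⟨b, k⟩) + fun k => y ⟨b, k⟩ := rfl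
  rw [out, hstate, dotProduct_add, Pi.add_apply, out, out]
  ring

theorem Diagram.add (h : S.Diagram x r i) (h' : S.Diagram y s j) :
    S.Diagram (x + y) (r + s) (i + j) := by
  constructor <;> simp only [out_add, Pi.add_apply]
  · rw [h.e_eq, h'.e_eq]; ring
  · rw [h.zr_eq, h'.zr_eq]
  · rw [h.z2_eq, h'.z2_eq]
  · rw [h.zs_eq, h'.zs_eq]
  · rw [h.v_eq, h'.v_eq]; ring
  · rw [h.u_eq, h'.u_eq]
  · rw [h.y_eq, h'.y_eq]

theorem field_add (x y : S.Idx → ℝ) (i j : Block → ℝ) :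
    S.field (x + y) (i + j) = S.field x i + S.field y j := by
  ext q
  have hstate : (fun k => (x + y) ⟨q.1, k⟩) = (fun k => x ⟨q.1, k⟩) + fun k => y ⟨q.1, k⟩ := rfl
  rw [field, hstate, Matrix.mulVec_add, Pi.add_apply, Pi.add_apply, Pi.add_apply, field, field]
  ring

theorem Arho_mulVec (v : Fin (S.sys Block.Cr).order → ℝ) :
    S.Arho *ᵥ v = v + ((S.γ - 1) * v S.rho) • Pi.single S.rho 1 := by
  ext k
  rw [Arho, Matrix.mulVec_diagonal]
  rcases eq_or_ne k S.rho with rfl | hk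
  · simp
    ring
  · simp [hk]

theorem jump_eq (x : S.Idx → ℝ) :
    S.jump x = x + ((S.γ - 1) * x ⟨Block.Cr, S.rho⟩) • S.eRho := by
  ext ⟨b, k⟩
  cases b
  case Cr =>
    change (S.Arho *ᵥ fun k => x ⟨Block.Cr, k⟩) k = _
    rw [Arho_mulVec]
    rcases eq_or_ne k S.rho with rfl | hk
    · simp [eRho]
    · have hne : (⟨Block.Cr, k⟩ : S.Idx) ≠ ⟨Block.Cr, S.rho⟩ := by simpa using hk
      simp [eRho, hk, hne]
  all_goals simp [jump, eRho]

theorem jump_add (x y : S.Idx → ℝ) : S.jump (x + y) = S.jump x + S.jump y := by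
  simp only [jump_eq, Pi.add_apply]
  module

theorem stateOut_eRho {b : Block} (hb : b ≠ Block.Cr) : S.stateOut S.eRho b = 0 := by
  have hzero : (fun k => S.eRho ⟨b, k⟩) = 0 :=
    funext fun k => Pi.single_eq_of_ne (fun h => hb (congrArg Sigma.fst h)) 1
  rw [stateOut, hzero, dotProduct_zero]

theorem IsBaseLinear.czs_rho (hS : S.NoFeedthrough) {Acl : Matrix S.Idx S.Idx ℝ}
    {czs : S.Idx → ℝ} (h : S.IsBaseLinear Acl czs) : czs ⟨Block.Cr, S.rho⟩ = 0 := by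
  have hout := (h _ _ (diagram_solve hS S.eRho 0)).2
  rw [eRho, dotProduct_single_one] at hout
  rw [← hout]
  change S.stateOut S.eRho Block.Cs + (S.sys Block.Cs).D * S.solveZ S.eRho 0 = 0
  simp [solveZ, stateOut_eRho]

@[fun_prop]
theorem continuousOn_stateOut {s : Set ℝ} {X : ℝ → S.Idx → ℝ} (hX : ContinuousOn X s)
    (b : Block) : ContinuousOn (fun t => S.stateOut (X t) b) s :=
  continuousOn_dotProduct _ (continuousOn_pi.2 fun _ => continuousOn_pi.1 hX _)

theorem continuousOn_solve {s : Set ℝ} {X : ℝ → S.Idx → ℝ} (hX : ContinuousOn X s) {r : ℝ → ℝ}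
    (hr : ContinuousOn r s) (b : Block) : ContinuousOn (fun t => S.solve (X t) (r t) b) s := by
  cases b <;> simp only [solve, solveZ, solveV, solveU, solveY] <;> fun_prop

end BlockDiagram

end ResetLoop

/-! ### Half-wave antisymmetry of the steady state -/

theorem continuousOn_update_Icc {E : Type*} [TopologicalSpace E] {x : ℝ → E} {v : E} {a b : ℝ}
    (ha : Tendsto x (𝓝[>] a) (𝓝 v)) (hc : ∀ t ∈ Ioo a b, ContinuousAt x t)
    (hb : ContinuousWithinAt x (Iic b) b) : ContinuousOn (Function.update x a v) (Icc a b) := by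
  have hsub : Icc a b \ {a} ⊆ Ioc a b := fun t ht => ⟨ht.1.1.lt_of_ne' ht.2, ht.1.2⟩
  refine continuousOn_update_iff.2
    ⟨fun t ht => ?_, fun _ => ha.mono_left (nhdsWithin_mono _ fun t ht => (hsub ht).1)⟩
  rcases (hsub ht).2.eq_or_lt with rfl | hlt
  · exact hb.mono fun y hy => hy.1.2
  · exact (hc t ⟨(hsub ht).1, hlt⟩).continuousWithinAt

theorem hasDerivAt_update_of_ne {E : Type*} [NormedAddCommGroup E] [NormedSpace ℝ E] {x : ℝ → E}
    {x' : E} {a t : ℝ} (hx : HasDerivAt x x' t) (ht : t ≠ a) (v : E) :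
    HasDerivAt (Function.update x a v) x' t :=
  hx.congr_of_eventuallyEq <| (isOpen_ne.eventually_mem ht).mono fun _ hs =>
    Function.update_of_ne hs _ _

theorem mul_sin_mul_add_pi_div {ω : ℝ} (hω : ω ≠ 0) (R t : ℝ) :
    R * Real.sin (ω * (t + Real.pi / ω)) = -(R * Real.sin (ω * t)) := by
  rw [mul_add, mul_div_cancel₀ _ hω, Real.sin_add_pi, mul_neg]

namespace ResetLoop

/-- What half-wave antisymmetry needs from the `H_β` condition: the base-linear closed loop has no
characteristic frequency at a harmonic of `ω`, and `H_β` has nonnegative real part at the even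
harmonics. -/
def HBetaOnHarmonics (S : ResetLoop) (ω : ℝ) : Prop :=
  ∃ (Acl : Matrix S.Idx S.Idx ℝ) (czs : S.Idx → ℝ) (β p : ℝ), S.IsBaseLinear Acl czs ∧
    (∀ k : ℤ, (pencil Acl (Complex.I * (k * ω : ℝ))).det ≠ 0) ∧ 0 < p ∧
    ∀ k : ℤ, Even k →
      0 ≤ (transferFn Acl S.eRho (β • czs + p • S.eRho) (Complex.I * (k * ω : ℝ))).re

/-- A reset instant: the zero crossing of the first harmonic of the trigger signal at which that
harmonic has phase `0`. -/
noncomputable def resetTime (S : ResetLoop) (ω : ℝ) (x : ℝ → S.Idx → ℝ) (inp : ℝ → Block → ℝ) :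
    ℝ :=
  -(phasor ω 1 (S.trigger x inp)).arg / ω

/-- The sum of `x` and its shift by half a period, which vanishes if and only if `x` is half-wave
antisymmetric. -/
noncomputable def halfWaveSum {E : Type*} [Add E] (ω : ℝ) (x : ℝ → E) (t : ℝ) : E :=
  x t + x (t + Real.pi / ω)

section HalfWave

variable {S : ResetLoop} {ω R : ℝ} {x : ℝ → S.Idx → ℝ} {inp : ℝ → Block → ℝ}

theorem HBeta.onHarmonics (hβ : S.HBeta) (ω : ℝ) : S.HBetaOnHarmonics ω := by
  obtain ⟨Acl, czs, β, p, hbl, hA, hp, ε, hε, -, hpos⟩ := hβ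
  have hre : ∀ k : ℤ, (Complex.I * (k * ω : ℝ)).re = 0 := fun k => by simp
  exact ⟨Acl, czs, β, p, hbl, fun k => hA.det_pencil_ne_zero (hre k).ge, hp,
    fun k _ => hpos _ (by rw [hre]; exact neg_lt_zero.2 hε)⟩

theorem IsTwoReset.mem_resetInstants_iff (htwo : S.IsTwoReset ω x inp) (hω : ω ≠ 0) (t : ℝ) :
    t ∈ S.resetInstants x inp ↔ Real.sin (ω * (t - S.resetTime ω x inp)) = 0 := by
  rw [resetInstants, mem_ofPred_eq, htwo.zeros, mul_eq_zero, norm_eq_zero,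
    or_iff_right htwo.first_ne_zero, resetTime, mul_sub, mul_div_cancel₀ _ hω, sub_neg_eq_add]

theorem IsTwoReset.add_pi_div_mem_iff (htwo : S.IsTwoReset ω x inp) (hω : ω ≠ 0) (t : ℝ) :
    t + Real.pi / ω ∈ S.resetInstants x inp ↔ t ∈ S.resetInstants x inp := by
  rw [htwo.mem_resetInstants_iff hω, htwo.mem_resetInstants_iff hω, add_sub_right_comm, mul_add,
    mul_div_cancel₀ _ hω, Real.sin_add_pi, neg_eq_zero]

theorem IsTwoReset.resetTime_mem (htwo : S.IsTwoReset ω x inp) (hω : ω ≠ 0) :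
    S.resetTime ω x inp ∈ S.resetInstants x inp := by
  rw [htwo.mem_resetInstants_iff hω, sub_self, mul_zero, Real.sin_zero]

theorem IsTwoReset.resetTime_add_pi_div_mem (htwo : S.IsTwoReset ω x inp) (hω : ω ≠ 0) :
    S.resetTime ω x inp + Real.pi / ω ∈ S.resetInstants x inp :=
  (htwo.add_pi_div_mem_iff hω _).2 (htwo.resetTime_mem hω)

theorem IsTwoReset.notMem_resetInstants (htwo : S.IsTwoReset ω x inp) (hω : 0 < ω) {t : ℝ}
    (ht : t ∈ Ioo (S.resetTime ω x inp) (S.resetTime ω x inp + Real.pi / ω)) :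
    t ∉ S.resetInstants x inp := by
  rw [htwo.mem_resetInstants_iff hω.ne']
  refine (Real.sin_pos_of_pos_of_lt_pi (mul_pos hω (sub_pos.2 ht.1)) ?_).ne'
  rw [← lt_div_iff₀' hω]
  linarith [ht.2]

theorem IsSteadyState.diagram_halfWaveSum (hss : S.IsSteadyState ω R x inp) (hω : ω ≠ 0) (t : ℝ) :
    S.Diagram (halfWaveSum ω x t) 0 (halfWaveSum ω inp t) := by
  have hsum := (hss.diagram t).add (hss.diagram (t + Real.pi / ω))
  rwa [mul_sin_mul_add_pi_div hω, add_neg_cancel] at hsum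

theorem IsSteadyState.periodic_halfWaveSum (hss : S.IsSteadyState ω R x inp) :
    Function.Periodic (halfWaveSum ω x) (Real.pi / ω) := fun t => by
  have hper := hss.periodic t
  rw [mul_div_assoc, two_mul, ← add_assoc] at hper
  rw [halfWaveSum, hper, add_comm, halfWaveSum]

theorem IsSteadyState.hasDerivAt_halfWaveSum (hss : S.IsSteadyState ω R x inp)
    (htwo : S.IsTwoReset ω x inp) (hω : ω ≠ 0) {Acl : Matrix S.Idx S.Idx ℝ} {czs : S.Idx → ℝ}
    (hbl : S.IsBaseLinear Acl czs) {t : ℝ} (ht : t ∉ S.resetInstants x inp) :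
    HasDerivAt (halfWaveSum ω x) (Acl *ᵥ halfWaveSum ω x t) t := by
  have ht' : t + Real.pi / ω ∉ S.resetInstants x inp :=
    mt (htwo.add_pi_div_mem_iff hω t).1 ht
  rw [← (hbl _ _ (hss.diagram_halfWaveSum hω t)).1, halfWaveSum, halfWaveSum, field_add]
  exact (hss.flow t ht).add ((hss.flow _ ht').comp_add_const t _)

theorem IsSteadyState.tendsto_halfWaveSum (hss : S.IsSteadyState ω R x inp)
    (htwo : S.IsTwoReset ω x inp) (hω : ω ≠ 0) {t : ℝ} (ht : t ∈ S.resetInstants x inp) :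
    Tendsto (halfWaveSum ω x) (𝓝[>] t) (𝓝 (S.jump (halfWaveSum ω x t))) := by
  have hshift : Tendsto (· + Real.pi / ω) (𝓝[>] t) (𝓝[>] (t + Real.pi / ω)) :=
    (continuous_add_const _).continuousWithinAt.tendsto_nhdsWithin
      fun s (hs : t < s) => add_lt_add_left hs _
  rw [halfWaveSum, jump_add]
  exact (hss.reset t ht).add ((hss.reset _ ((htwo.add_pi_div_mem_iff hω t).2 ht)).comp hshift)

theorem IsSteadyState.continuousWithinAt_halfWaveSum (hss : S.IsSteadyState ω R x inp)
    (htwo : S.IsTwoReset ω x inp) (hω : ω ≠ 0) {t : ℝ} (ht : t ∈ S.resetInstants x inp) :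
    ContinuousWithinAt (halfWaveSum ω x) (Iic t) t :=
  (hss.left_cont t ht).add <| ContinuousWithinAt.comp (f := (· + Real.pi / ω))
    (hss.left_cont _ ((htwo.add_pi_div_mem_iff hω t).2 ht))
    (continuous_add_const _).continuousWithinAt fun s (hs : s ≤ t) => add_le_add_left hs _

theorem IsTwoReset.out_halfWaveSum_Cs (htwo : S.IsTwoReset ω x inp) (hω : ω ≠ 0) {t : ℝ}
    (ht : t ∈ S.resetInstants x inp) :
    S.out (halfWaveSum ω x t) (halfWaveSum ω inp t) Block.Cs = 0 := by
  have hzero : S.trigger x inp t = 0 := ht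
  have hzero' : S.trigger x inp (t + Real.pi / ω) = 0 := (htwo.add_pi_div_mem_iff hω t).2 ht
  rw [trigger] at hzero hzero'
  rw [halfWaveSum, halfWaveSum, out_add, hzero, hzero', add_zero]

theorem quasiFreq_zero_pi_div (ω : ℝ) (k : ℤ) :
    quasiFreq 0 (Real.pi / ω) k = Complex.I * ((2 * k : ℤ) * ω : ℝ) := by
  rw [quasiFreq]
  congr 2
  push_cast
  field_simp
  ring

theorem IsSteadyState.halfWaveSum_eq_zero_of_mem_Ioc (hss : S.IsSteadyState ω R x inp)
    (htwo : S.IsTwoReset ω x inp) (hω : 0 < ω) (hS : S.NoFeedthrough)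
    (hβ : S.HBetaOnHarmonics ω) {t : ℝ}
    (ht : t ∈ Ioc (S.resetTime ω x inp) (S.resetTime ω x inp + Real.pi / ω)) :
    halfWaveSum ω x t = 0 := by
  obtain ⟨Acl, czs, β, p, hbl, hdet, hp, hpos⟩ := hβ
  have hmem := htwo.resetTime_mem hω.ne'
  have hmem' := htwo.resetTime_add_pi_div_mem hω.ne'
  have hnotMem := fun {s} => htwo.notMem_resetInstants (t := s) hω
  set a := S.resetTime ω x inp
  have hd := fun {s} hs => hss.hasDerivAt_halfWaveSum htwo hω.ne' hbl (hnotMem (s := s) hs)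
  have hab : a < a + Real.pi / ω := lt_add_of_pos_right a (div_pos Real.pi_pos hω)
  rw [← Function.update_of_ne ht.1.ne' (S.jump (halfWaveSum ω x a)) (halfWaveSum ω x)]
  refine eq_zero_of_passive_reset (A := Acl) (β := β) hab hp S.γ_mem
    (fun k => ?_) (fun k => ?_)
    (continuousOn_update_Icc (hss.tendsto_halfWaveSum htwo hω.ne' hmem)
      (fun s hs => (hd hs).continuousAt) (hss.continuousWithinAt_halfWaveSum htwo hω.ne' hmem'))
    (fun s hs => ?_) ?_ (hbl.czs_rho hS) ?_ (Ioc_subset_Icc_self ht)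
  · rw [add_sub_cancel_left, quasiFreq_zero_pi_div]
    exact hdet _
  · rw [add_sub_cancel_left, quasiFreq_zero_pi_div]
    exact hpos _ (even_two_mul k)
  · rw [Function.update_of_ne hs.1.ne']
    exact hasDerivAt_update_of_ne (hd hs) hs.1.ne' _
  · rw [Function.update_self, Function.update_of_ne hab.ne', hss.periodic_halfWaveSum, jump_eq]
    rfl
  · rw [Function.update_of_ne hab.ne', ← (hbl _ _ (hss.diagram_halfWaveSum hω.ne' _)).2,
      htwo.out_halfWaveSum_Cs hω.ne' hmem']

theorem IsSteadyState.halfWaveSum_eq_zero (hss : S.IsSteadyState ω R x inp)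
    (htwo : S.IsTwoReset ω x inp) (hω : 0 < ω) (hS : S.NoFeedthrough)
    (hβ : S.HBetaOnHarmonics ω) (t : ℝ) : halfWaveSum ω x t = 0 := by
  obtain ⟨k, hk, -⟩ := existsUnique_add_zsmul_mem_Ioc (div_pos Real.pi_pos hω) t
    (S.resetTime ω x inp)
  rw [← hss.halfWaveSum_eq_zero_of_mem_Ioc htwo hω hS hβ hk]
  exact (hss.periodic_halfWaveSum.zsmul k t).symm

theorem IsSteadyState.antiperiodic (hss : S.IsSteadyState ω R x inp)
    (htwo : S.IsTwoReset ω x inp) (hω : 0 < ω) (hS : S.NoFeedthrough)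
    (hβ : S.HBetaOnHarmonics ω) : Function.Antiperiodic x (Real.pi / ω) := fun t =>
  eq_neg_of_add_eq_zero_right (hss.halfWaveSum_eq_zero htwo hω hS hβ t)

end HalfWave

end ResetLoop

/-! ### The base-linear loop gain -/

section

variable {ι : Type*} [Fintype ι]

theorem map_ofReal_dotProduct (L : ℂ →ₗ[ℝ] ℝ) (c : ι → ℝ) (ξ : ι → ℂ) :
    L ((fun i => (c i : ℂ)) ⬝ᵥ ξ) = c ⬝ᵥ fun i => L (ξ i) := by
  simp only [dotProduct, map_sum, ← Complex.real_smul, map_smul, smul_eq_mul]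

end

namespace LTI

theorem charMat_mulVec_stateTF (G : LTI) {s : ℂ} (h : (G.charMat s).det ≠ 0) :
    G.charMat s *ᵥ G.stateTF s = fun i => (G.B i : ℂ) := by
  rw [stateTF, Matrix.mulVec_mulVec, Matrix.mul_nonsing_inv _ (isUnit_iff_ne_zero.2 h),
    Matrix.one_mulVec]

theorem mul_mul_stateTF (G : LTI) {s : ℂ} (h : (G.charMat s).det ≠ 0) (c : ℂ)
    (i : Fin G.order) : s * (c * G.stateTF s i) =
      ((fun j => (G.A i j : ℂ)) ⬝ᵥ fun j => c * G.stateTF s j) + (G.B i : ℂ) * c := by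
  have hi := congrFun (G.charMat_mulVec_stateTF h) i
  simp only [charMat, Matrix.sub_mulVec, Matrix.smul_mulVec, Matrix.one_mulVec, Pi.sub_apply,
    Pi.smul_apply, smul_eq_mul] at hi
  have hc : ((fun j => (G.A i j : ℂ)) ⬝ᵥ fun j => c * G.stateTF s j) =
      c * (G.A.map Complex.ofReal *ᵥ G.stateTF s) i := dotProduct_smul c _ _
  linear_combination c * hi - hc

end LTI

namespace ResetLoop

variable {S : ResetLoop}

/-- State phasors of the blocks when they are driven at complex frequency `s` by the input phasors
`V`. -/
noncomputable def harmonicState (S : ResetLoop) (s : ℂ) (V : Block → ℂ) : S.Idx → ℂ :=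
  fun q => V q.1 * (S.sys q.1).stateTF s q.2

theorem out_harmonicState (L : ℂ →ₗ[ℝ] ℝ) (s : ℂ) (V : Block → ℂ) (b : Block) :
    S.out (fun q => L (S.harmonicState s V q)) (fun b => L (V b)) b =
      L ((S.sys b).tf s * V b) := by
  have hC : ((fun i => ((S.sys b).C i : ℂ)) ⬝ᵥ fun i => S.harmonicState s V ⟨b, i⟩) =
      V b * ((fun i => ((S.sys b).C i : ℂ)) ⬝ᵥ (S.sys b).stateTF s) :=
    dotProduct_smul (V b) _ _
  rw [out, LTI.tf, add_mul, mul_comm _ (V b), ← hC, map_add, map_ofReal_dotProduct,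
    ← Complex.real_smul, map_smul, smul_eq_mul]

theorem field_harmonicState (L : ℂ →ₗ[ℝ] ℝ) {s : ℂ}
    (hs : ∀ b, ((S.sys b).charMat s).det ≠ 0) (V : Block → ℂ) (q : S.Idx) :
    S.field (fun q => L (S.harmonicState s V q)) (fun b => L (V b)) q =
      L (s * S.harmonicState s V q) := by
  rw [harmonicState, (S.sys q.1).mul_mul_stateTF (hs q.1), map_add, map_ofReal_dotProduct,
    ← Complex.real_smul, map_smul, smul_eq_mul]
  rfl

/-- A nonzero unforced harmonic response of the loop would make `s` an eigenvalue of `Acl`. -/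
theorem IsBaseLinear.inp_eq_zero (hS : S.NoFeedthrough) {Acl : Matrix S.Idx S.Idx ℝ}
    {czs : S.Idx → ℝ} (hbl : S.IsBaseLinear Acl czs) {s : ℂ} (hA : (pencil Acl s).det ≠ 0)
    (hs : ∀ b, ((S.sys b).charMat s).det ≠ 0) {V : Block → ℂ}
    (hV : ∀ L : ℂ →ₗ[ℝ] ℝ, S.Diagram (fun q => L (S.harmonicState s V q)) 0 (fun b => L (V b))) :
    V = 0 := by
  have hfield : ∀ (L : ℂ →ₗ[ℝ] ℝ) q, L ((pencil Acl s *ᵥ S.harmonicState s V) q) = 0 := by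
    intro L q
    have hq := congrFun (hbl _ _ (hV L)).1 q
    rw [field_harmonicState L hs V q] at hq
    simp only [pencil, Matrix.sub_mulVec, Matrix.smul_mulVec, Matrix.one_mulVec, Pi.sub_apply,
      Pi.smul_apply, smul_eq_mul, map_sub, hq, sub_eq_zero]
    exact (map_ofReal_dotProduct L (Acl q) _).symm
  have hker : pencil Acl s *ᵥ S.harmonicState s V = 0 := funext fun q =>
    Complex.ext (hfield Complex.reLm q) (hfield Complex.imLm q)
  have hξ : S.harmonicState s V = 0 := by
    rw [eq_inv_mulVec_of_mulVec_eq hA hker, Matrix.mulVec_zero]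
  have hLV : ∀ L : ℂ →ₗ[ℝ] ℝ, (fun b => L (V b)) = 0 := fun L =>
    Diagram.eq_zero hS (by simpa [hξ, Pi.zero_def] using hV L)
  exact funext fun b =>
    Complex.ext (congrFun (hLV Complex.reLm) b) (congrFun (hLV Complex.imLm) b)

/-- The input phasors obtained by sending `z = 1` once around the base-linear loop. -/
noncomputable def openLoopInp (S : ResetLoop) (ω : ℝ) (n : ℕ) : Block → ℂ
  | .Cr => 1
  | .C2 => 1
  | .Cs => 1
  | .C3 => S.fr ω n .Cr + S.fr ω n .C2
  | .P => S.fr ω n .C3 * (S.fr ω n .Cr + S.fr ω n .C2)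
  | .C4 => S.fr ω n .P * (S.fr ω n .C3 * (S.fr ω n .Cr + S.fr ω n .C2))
  | .C1 => -(S.fr ω n .C4 * (S.fr ω n .P * (S.fr ω n .C3 * (S.fr ω n .Cr + S.fr ω n .C2))))

theorem diagram_openLoopInp {ω : ℝ} {n : ℕ} (h : 1 + S.Ll ω n = 0) (L : ℂ →ₗ[ℝ] ℝ) :
    S.Diagram (fun q => L (S.harmonicState (jw ω n) (S.openLoopInp ω n) q)) 0
      (fun b => L (S.openLoopInp ω n b)) := by
  have hC1 : (S.sys .C1).tf (jw ω n) * S.openLoopInp ω n .C1 = 1 := by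
    simp only [Ll, openLoopInp, fr] at h ⊢
    linear_combination -h
  constructor <;> simp only [out_harmonicState, hC1] <;>
    simp only [openLoopInp, fr, mul_one, map_add, map_neg, zero_sub]

theorem one_add_Ll_ne_zero (hS : S.NoFeedthrough) {Acl : Matrix S.Idx S.Idx ℝ}
    {czs : S.Idx → ℝ} (hbl : S.IsBaseLinear Acl czs) {ω : ℝ} {n : ℕ}
    (hA : (pencil Acl (jw ω n)).det ≠ 0) (hs : ∀ b, ((S.sys b).charMat (jw ω n)).det ≠ 0) :
    1 + S.Ll ω n ≠ 0 := fun h =>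
  one_ne_zero (congrFun (hbl.inp_eq_zero hS hA hs (diagram_openLoopInp h)) .Cr)

end ResetLoop

/-! ### Harmonics of the steady state -/

namespace ResetLoop

/-- The state from a reset onwards, with the value just after that reset in place of the value
just before it: a continuous function on the half period up to the next reset. -/
noncomputable def arc (S : ResetLoop) (ω : ℝ) (x : ℝ → S.Idx → ℝ) (inp : ℝ → Block → ℝ) :
    ℝ → S.Idx → ℝ :=
  Function.update x (S.resetTime ω x inp) (S.jump (x (S.resetTime ω x inp)))

/-- No block has a characteristic frequency at an odd multiple of `ω`. -/
def NonResonant (S : ResetLoop) (ω : ℝ) : Prop :=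
  ∀ b : Block, ∀ n : ℕ, Odd n → ((S.sys b).charMat (jw ω n)).det ≠ 0

/-- A steady-state response with two resets per cycle and half-wave antisymmetric state. -/
structure HalfWaveResponse (S : ResetLoop) (ω R : ℝ) (x : ℝ → S.Idx → ℝ)
    (inp : ℝ → Block → ℝ) : Prop where
  pos : 0 < ω
  noFeedthrough : S.NoFeedthrough
  steady : S.IsSteadyState ω R x inp
  twoReset : S.IsTwoReset ω x inp
  antiperiodic : Function.Antiperiodic x (Real.pi / ω)

/-- Phasor of the input of block `b`. -/
noncomputable def inpPhasor (ω : ℝ) (inp : ℝ → Block → ℝ) (n : ℕ) (b : Block) : ℂ :=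
  phasor ω n (fun t => inp t b)

/-- Phasor of the output of block `b`. -/
noncomputable def outPhasor (S : ResetLoop) (ω : ℝ) (x : ℝ → S.Idx → ℝ) (inp : ℝ → Block → ℝ)
    (n : ℕ) (b : Block) : ℂ :=
  phasor ω n (fun t => S.out (x t) (inp t) b)

/-- Phasors of the state of block `b`. -/
noncomputable def statePhasor (S : ResetLoop) (ω : ℝ) (x : ℝ → S.Idx → ℝ) (n : ℕ) (b : Block) :
    Fin (S.sys b).order → ℂ :=
  fun i => phasor ω n (fun t => x t ⟨b, i⟩)

section

variable {S : ResetLoop} {ω R : ℝ} {x : ℝ → S.Idx → ℝ} {inp : ℝ → Block → ℝ}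

theorem arc_of_gt {t : ℝ} (ht : S.resetTime ω x inp < t) : S.arc ω x inp t = x t :=
  Function.update_of_ne ht.ne' _ _

theorem arc_resetTime :
    S.arc ω x inp (S.resetTime ω x inp) = S.jump (x (S.resetTime ω x inp)) :=
  Function.update_self _ _ _

namespace HalfWaveResponse

variable (H : HalfWaveResponse S ω R x inp) {n : ℕ}

include H

theorem pi_div_pos : 0 < Real.pi / ω := div_pos Real.pi_pos H.pos

theorem resetTime_lt : S.resetTime ω x inp < S.resetTime ω x inp + Real.pi / ω :=
  lt_add_of_pos_right _ H.pi_div_pos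

theorem continuousOn_arc : ContinuousOn (S.arc ω x inp)
    (Icc (S.resetTime ω x inp) (S.resetTime ω x inp + Real.pi / ω)) :=
  continuousOn_update_Icc (H.steady.reset _ (H.twoReset.resetTime_mem H.pos.ne'))
    (fun t ht => (H.steady.flow t (H.twoReset.notMem_resetInstants H.pos ht)).continuousAt)
    (H.steady.left_cont _ (H.twoReset.resetTime_add_pi_div_mem H.pos.ne'))

theorem hasDerivAt_arc {t : ℝ}
    (ht : t ∈ Ioo (S.resetTime ω x inp) (S.resetTime ω x inp + Real.pi / ω)) :
    HasDerivAt (S.arc ω x inp) (S.field (x t) (inp t)) t :=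
  hasDerivAt_update_of_ne (H.steady.flow t (H.twoReset.notMem_resetInstants H.pos ht))
    ht.1.ne' _

theorem inp_antiperiodic : Function.Antiperiodic inp (Real.pi / ω) := fun t => by
  have hsum := (H.steady.diagram t).add (H.steady.diagram (t + Real.pi / ω))
  rw [mul_sin_mul_add_pi_div H.pos.ne', H.antiperiodic, add_neg_cancel, add_neg_cancel] at hsum
  exact eq_neg_of_add_eq_zero_right (hsum.eq_zero H.noFeedthrough)

theorem continuousOn_solve_arc (b : Block) : ContinuousOn
    (fun t => S.solve (S.arc ω x inp t) (R * Real.sin (ω * t)) b)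
    (Icc (S.resetTime ω x inp) (S.resetTime ω x inp + Real.pi / ω)) :=
  continuousOn_solve H.continuousOn_arc (by fun_prop) b

theorem inp_eq_solve_arc {t : ℝ} (ht : S.resetTime ω x inp < t) (b : Block) :
    inp t b = S.solve (S.arc ω x inp t) (R * Real.sin (ω * t)) b := by
  rw [arc_of_gt ht, ← (H.steady.diagram t).eq_solve H.noFeedthrough]

theorem intervalIntegrable_of_eqOn {f g : ℝ → ℝ}
    (hf : Function.Antiperiodic f (Real.pi / ω)) (hg : ContinuousOn g
      (Icc (S.resetTime ω x inp) (S.resetTime ω x inp + Real.pi / ω)))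
    (hgf : EqOn g f (Ioi (S.resetTime ω x inp))) (c d : ℝ) : IntervalIntegrable f volume c d := by
  refine intervalIntegrable_of_antiperiodic hf H.pi_div_pos
    ((hg.intervalIntegrable_of_Icc H.resetTime_lt.le).congr fun t ht => hgf ?_) c d
  rw [uIoc_of_le H.resetTime_lt.le] at ht
  exact ht.1

theorem intervalIntegrable_state (q : S.Idx) (c d : ℝ) :
    IntervalIntegrable (fun t => x t q) volume c d :=
  H.intervalIntegrable_of_eqOn (fun t => congrFun (H.antiperiodic t) q)
    (continuousOn_pi.1 H.continuousOn_arc q) (fun _ ht => congrFun (arc_of_gt ht) q) c d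

theorem intervalIntegrable_inp (b : Block) (c d : ℝ) :
    IntervalIntegrable (fun t => inp t b) volume c d :=
  H.intervalIntegrable_of_eqOn (fun t => congrFun (H.inp_antiperiodic t) b)
    (H.continuousOn_solve_arc b) (fun _ ht => (H.inp_eq_solve_arc ht b).symm) c d

theorem intervalIntegrable_stateOut (b : Block) (c d : ℝ) :
    IntervalIntegrable (fun t => S.stateOut (x t) b) volume c d :=
  (IntervalIntegrable.sum Finset.univ fun i _ => (H.intervalIntegrable_state ⟨b, i⟩ c d).const_mul
    ((S.sys b).C i)).congr fun t _ => Finset.sum_apply t _ _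

theorem intervalIntegrable_out (b : Block) (c d : ℝ) :
    IntervalIntegrable (fun t => S.out (x t) (inp t) b) volume c d :=
  (H.intervalIntegrable_stateOut b c d).add ((H.intervalIntegrable_inp b c d).const_mul _)

theorem inpPhasor_of_even (hn : Even n) (b : Block) : inpPhasor ω inp n b = 0 :=
  phasor_of_antiperiodic_of_even (a := 0) H.pos (fun t => congrFun (H.inp_antiperiodic t) b)
    (H.intervalIntegrable_inp b _ _) hn

theorem outPhasor_eq (n : ℕ) (b : Block) : S.outPhasor ω x inp n b =
    (fun i => ((S.sys b).C i : ℂ)) ⬝ᵥ S.statePhasor ω x n b +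
      (S.sys b).D * inpPhasor ω inp n b := by
  rw [inpPhasor, ← phasor_const_mul]
  exact (phasor_add (H.intervalIntegrable_stateOut b _ _)
    ((H.intervalIntegrable_inp b _ _).const_mul _)).trans (congrArg₂ (· + ·)
      (phasor_dotProduct _ fun i => H.intervalIntegrable_state ⟨b, i⟩ _ _) rfl)

theorem inpPhasor_C3 (n : ℕ) : inpPhasor ω inp n Block.C3 =
    S.outPhasor ω x inp n Block.Cr + S.outPhasor ω x inp n Block.C2 := by
  rw [outPhasor, outPhasor, ← phasor_add (H.intervalIntegrable_out _ _ _)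
    (H.intervalIntegrable_out _ _ _), inpPhasor]
  simp only [fun t => (H.steady.diagram t).v_eq]

theorem inpPhasor_C1_add (n : ℕ) : inpPhasor ω inp n Block.C1 + S.outPhasor ω x inp n Block.C4 =
    if n = 1 then (R : ℂ) else 0 := by
  rw [inpPhasor, outPhasor, ← phasor_add (H.intervalIntegrable_inp _ _ _)
    (H.intervalIntegrable_out _ _ _), ← phasor_sin H.pos.ne' R one_ne_zero]
  simp only [fun t => (H.steady.diagram t).e_eq, sub_add_cancel, Nat.cast_one, one_mul]

theorem inpPhasor_eq_expIntegral (hn : Odd n) (b : Block) :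
    inpPhasor ω inp n b = 2 * Complex.I * (ω / Real.pi) *
      expIntegral (S.resetTime ω x inp) (S.resetTime ω x inp + Real.pi / ω) (jw ω n)
        (fun t => S.solve (S.arc ω x inp t) (R * Real.sin (ω * t)) b) := by
  rw [inpPhasor, phasor_of_antiperiodic_of_odd (a := S.resetTime ω x inp) H.pos
    (fun t => congrFun (H.inp_antiperiodic t) b) (H.intervalIntegrable_inp b _ _) hn]
  congr 1
  exact expIntegral_congr H.resetTime_lt.le fun t ht => H.inp_eq_solve_arc ht.1 b

theorem statePhasor_eq_expIntegral (hn : Odd n) (b : Block) :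
    S.statePhasor ω x n b = (2 * Complex.I * (ω / Real.pi)) • fun i =>
      expIntegral (S.resetTime ω x inp) (S.resetTime ω x inp + Real.pi / ω) (jw ω n)
        (fun t => S.arc ω x inp t ⟨b, i⟩) := by
  ext i
  rw [statePhasor, phasor_of_antiperiodic_of_odd (a := S.resetTime ω x inp) H.pos
    (fun t => congrFun (H.antiperiodic t) ⟨b, i⟩) (H.intervalIntegrable_state ⟨b, i⟩ _ _) hn]
  simp only [Pi.smul_apply, smul_eq_mul]
  congr 1
  exact expIntegral_congr H.resetTime_lt.le fun t ht => by simp only [arc_of_gt ht.1]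

theorem charMat_mulVec_statePhasor (hn : Odd n) (b : Block) :
    (S.sys b).charMat (jw ω n) *ᵥ S.statePhasor ω x n b = fun i =>
      (S.sys b).B i * inpPhasor ω inp n b + 2 * Complex.I * (ω / Real.pi) *
        Complex.exp (-(jw ω n * (S.resetTime ω x inp : ℝ))) *
        (S.jump (x (S.resetTime ω x inp)) ⟨b, i⟩ - x (S.resetTime ω x inp) ⟨b, i⟩ : ℝ) := by
  have hX : ContinuousOn (fun t (i : Fin (S.sys b).order) => S.arc ω x inp t ⟨b, i⟩)
      (Icc (S.resetTime ω x inp) (S.resetTime ω x inp + Real.pi / ω)) :=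
    continuousOn_pi.2 fun i => continuousOn_pi.1 H.continuousOn_arc ⟨b, i⟩
  have hd : ∀ t ∈ Ioo (S.resetTime ω x inp) (S.resetTime ω x inp + Real.pi / ω),
      HasDerivAt (fun t (i : Fin (S.sys b).order) => S.arc ω x inp t ⟨b, i⟩)
        ((S.sys b).A *ᵥ (fun i => S.arc ω x inp t ⟨b, i⟩) + fun i =>
          (S.sys b).B i * S.solve (S.arc ω x inp t) (R * Real.sin (ω * t)) b) t := fun t ht => by
    rw [← H.inp_eq_solve_arc ht.1, arc_of_gt ht.1]
    exact hasDerivAt_pi.2 fun i => hasDerivAt_pi.1 (H.hasDerivAt_arc ht) ⟨b, i⟩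
  have hcexp := cexp_neg_jw_mul_add_pi_div H.pos.ne' hn (S.resetTime ω x inp)
  have hpencil := pencil_mulVec_expIntegral (w := fun t i =>
    (S.sys b).B i * S.solve (S.arc ω x inp t) (R * Real.sin (ω * t)) b) H.resetTime_lt.le hX
    (continuousOn_pi.2 fun i => continuousOn_const.mul (H.continuousOn_solve_arc b)) hd (jw ω n)
  change pencil (S.sys b).A (jw ω n) *ᵥ _ = _
  rw [H.statePhasor_eq_expIntegral hn, H.inpPhasor_eq_expIntegral hn, Matrix.mulVec_smul, hpencil]
  ext i
  simp only [hcexp, arc_resetTime, arc_of_gt H.resetTime_lt, H.antiperiodic _, Pi.smul_apply,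
    smul_eq_mul, Pi.neg_apply, expIntegral_const_mul]
  push_cast
  ring

theorem outPhasor_of_ne (hfreq : S.NonResonant ω) (hn : Odd n) {b : Block} (hb : b ≠ Block.Cr) :
    S.outPhasor ω x inp n b = S.fr ω n b * inpPhasor ω inp n b := by
  have hstate : (S.sys b).charMat (jw ω n) *ᵥ S.statePhasor ω x n b =
      inpPhasor ω inp n b • fun i => ((S.sys b).B i : ℂ) := by
    rw [H.charMat_mulVec_statePhasor hn b]
    ext i
    have hjump : S.jump (x (S.resetTime ω x inp)) ⟨b, i⟩ = x (S.resetTime ω x inp) ⟨b, i⟩ := by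
      cases b <;> first | rfl | exact absurd rfl hb
    simp [hjump, mul_comm]
  rw [H.outPhasor_eq, eq_inv_mulVec_of_mulVec_eq (hfreq b n hn) hstate, Matrix.mulVec_smul,
    dotProduct_smul, smul_eq_mul, fr, LTI.tf, LTI.stateTF]
  ring

end HalfWaveResponse

end

end ResetLoop

/-! ### The reset amplitude -/

section

variable {ω a : ℝ}

theorem quasiFreq_natCast (hω : ω ≠ 0) (k : ℕ) :
    quasiFreq ω (Real.pi / ω) k = jw ω (2 * k + 1) := by
  rw [quasiFreq, jw]
  congr 2
  push_cast
  field_simp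
  ring

theorem quasiFreq_neg_natCast_add_one (hω : ω ≠ 0) (k : ℕ) :
    quasiFreq ω (Real.pi / ω) (-(k + 1)) = -jw ω (2 * k + 1) := by
  rw [quasiFreq, jw, ← mul_neg, ← Complex.ofReal_neg]
  congr 2
  push_cast
  field_simp
  ring

theorem conj_jw (ω : ℝ) (n : ℕ) : starRingEnd ℂ (jw ω n) = -jw ω n := by
  rw [jw, map_mul, Complex.conj_I, Complex.conj_ofReal, neg_mul]

theorem det_pencil_conj {ι : Type*} [Fintype ι] [DecidableEq ι] (A : Matrix ι ι ℝ) (s : ℂ) :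
    (pencil A (starRingEnd ℂ s)).det = starRingEnd ℂ (pencil A s).det := by
  rw [RingHom.map_det]
  congr 1
  ext i j
  simp [pencil, Matrix.one_apply, apply_ite (starRingEnd ℂ)]

theorem hasSum_im_expIntegral_mul_cexp (hω : 0 < ω) {f f' : ℝ → ℝ}
    (hf : ContinuousOn f (Icc a (a + Real.pi / ω)))
    (hd : ∀ t ∈ Ioo a (a + Real.pi / ω), HasDerivAt f (f' t) t)
    (hf' : ContinuousOn f' (Icc a (a + Real.pi / ω))) (h : f (a + Real.pi / ω) = -f a) :
    HasSum (fun k : ℕ => (2 * Complex.I * (ω / Real.pi) *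
      expIntegral a (a + Real.pi / ω) (jw ω (2 * k + 1)) f *
        Complex.exp (jw ω (2 * k + 1) * a)).im) (f a) := by
  have hlt : a < a + Real.pi / ω := lt_add_of_pos_right _ (div_pos Real.pi_pos hω)
  have hend : (f (a + Real.pi / ω) : ℂ) =
      Complex.exp (Complex.I * ω * ((a + Real.pi / ω : ℝ) - a)) * f a := by
    rw [Complex.ofReal_add, add_sub_cancel_left, Complex.ofReal_div,
      cexp_I_mul_mul_pi_div hω.ne', h]
    simp
  have hsum := (hasSum_expIntegral_mul_cexp hlt hf hd hf' hend
    (left_mem_Icc.2 hlt.le)).nat_add_neg_add_one.mapL Complex.reCLM |>.mul_left (ω / Real.pi)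
  simp only [add_sub_cancel_left, quasiFreq_natCast hω.ne',
    quasiFreq_neg_natCast_add_one hω.ne'] at hsum
  have hval : ω / Real.pi * Complex.reCLM (((a + Real.pi / ω : ℝ) - a : ℂ) * f a) = f a := by
    rw [Complex.ofReal_add, add_sub_cancel_left, ← Complex.ofReal_mul, Complex.reCLM_apply,
      Complex.ofReal_re]
    field_simp
  rw [hval] at hsum
  refine hsum.congr_fun fun k => ?_
  have hconj : Complex.exp (-jw ω (2 * k + 1) * a) =
      starRingEnd ℂ (Complex.exp (jw ω (2 * k + 1) * a)) := by
    rw [← Complex.exp_conj, map_mul, conj_jw, Complex.conj_ofReal]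
  have hterm (w : ℂ) : (2 * Complex.I * (ω / Real.pi) * w).im = ω / Real.pi * (2 * w.re) := by
    have hI : 2 * Complex.I * (ω / Real.pi) * w = (ω / Real.pi * 2 : ℝ) * (Complex.I * w) := by
      push_cast
      ring
    rw [hI, Complex.im_ofReal_mul, Complex.I_mul_im, mul_assoc]
  rw [hconj, jw, expIntegral_neg_I_mul, ← map_mul, Complex.add_conj, Complex.reCLM_apply,
    Complex.ofReal_re, mul_assoc, hterm]

theorem LTI.expIntegral_eq_mul_stateTF (G : LTI) (hω : 0 < ω) {X : ℝ → Fin G.order → ℝ}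
    {u : ℝ → ℝ} (hX : ContinuousOn X (Icc a (a + Real.pi / ω)))
    (hu : ContinuousOn u (Icc a (a + Real.pi / ω)))
    (hd : ∀ t ∈ Ioo a (a + Real.pi / ω),
      HasDerivAt X (G.A *ᵥ X t + fun i => G.B i * u t) t)
    (h : X (a + Real.pi / ω) = -X a) {n : ℕ} (hn : Odd n) (hdet : (G.charMat (jw ω n)).det ≠ 0)
    (i : Fin G.order) : expIntegral a (a + Real.pi / ω) (jw ω n) (fun t => X t i) =
      expIntegral a (a + Real.pi / ω) (jw ω n) u * G.stateTF (jw ω n) i := by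
  have hpencil := pencil_mulVec_expIntegral (w := fun t i => G.B i * u t)
    (le_add_of_nonneg_right (div_pos Real.pi_pos hω).le) hX
    (continuousOn_pi.2 fun i => continuousOn_const.mul hu) hd (jw ω n)
  have hstate : pencil G.A (jw ω n) *ᵥ (fun i =>
        expIntegral a (a + Real.pi / ω) (jw ω n) (fun t => X t i)) =
      expIntegral a (a + Real.pi / ω) (jw ω n) u • fun i => (G.B i : ℂ) := by
    rw [hpencil, cexp_neg_jw_mul_add_pi_div hω.ne' hn, h]
    ext i
    simp only [expIntegral_const_mul, Pi.neg_apply, Pi.smul_apply, smul_eq_mul]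
    push_cast
    ring
  have hi := congrFun (eq_inv_mulVec_of_mulVec_eq hdet hstate) i
  rwa [Matrix.mulVec_smul] at hi

end

namespace ResetLoop

theorem NonResonant.det_pencil_ne_zero {S : ResetLoop} {ω : ℝ} (h : S.NonResonant ω)
    (hω : ω ≠ 0) (b : Block) (k : ℤ) :
    (pencil (S.sys b).A (quasiFreq ω (Real.pi / ω) k)).det ≠ 0 := by
  cases k with
  | ofNat n =>
    rw [Int.ofNat_eq_natCast, quasiFreq_natCast hω]
    exact h b _ (odd_two_mul_add_one n)
  | negSucc n =>
    rw [Int.negSucc_eq, quasiFreq_neg_natCast_add_one hω, ← conj_jw, det_pencil_conj]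
    exact (map_ne_zero _).2 (h b _ (odd_two_mul_add_one n))

/-- State of the reset controller just before a reset. -/
noncomputable def resetState (S : ResetLoop) (ω : ℝ) (x : ℝ → S.Idx → ℝ)
    (inp : ℝ → Block → ℝ) : Fin (S.sys Block.Cr).order → ℝ :=
  fun i => x (S.resetTime ω x inp) ⟨Block.Cr, i⟩

/-- The free response of `Cr` whose antiperiodic continuation has the same jump at the resets as
the state of `Cr`. -/
noncomputable def resetResponse (S : ResetLoop) (ω : ℝ) (x : ℝ → S.Idx → ℝ)
    (inp : ℝ → Block → ℝ) (t : ℝ) : Fin (S.sys Block.Cr).order → ℝ :=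
  NormedSpace.exp ((t - S.resetTime ω x inp) • (S.sys Block.Cr).A) *ᵥ
    ((1 + S.expAR ω)⁻¹ *ᵥ ((S.Arho - 1) *ᵥ S.resetState ω x inp))

/-- The part of the state of `Cr` that its input drives through the base-linear controller. -/
noncomputable def baseLinearArc (S : ResetLoop) (ω : ℝ) (x : ℝ → S.Idx → ℝ)
    (inp : ℝ → Block → ℝ) (t : ℝ) : Fin (S.sys Block.Cr).order → ℝ :=
  (fun i => S.arc ω x inp t ⟨Block.Cr, i⟩) - S.resetResponse ω x inp t

/-- The factor `κ` such that the state of `Cr` jumps by `κ Δ_q`. -/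
noncomputable def resetAmplitude (S : ResetLoop) (ω : ℝ) (x : ℝ → S.Idx → ℝ)
    (inp : ℝ → Block → ℝ) : ℝ :=
  S.baseLinearArc ω x inp (S.resetTime ω x inp) S.rho / S.DeltaC1 ω

section

variable {S : ResetLoop} {ω R : ℝ} {x : ℝ → S.Idx → ℝ} {inp : ℝ → Block → ℝ}

theorem Arho_sub_one_mulVec (v : Fin (S.sys Block.Cr).order → ℝ) :
    (S.Arho - 1) *ᵥ v = ((S.γ - 1) * v S.rho) • Pi.single S.rho 1 := by
  rw [Matrix.sub_mulVec, Arho_mulVec, Matrix.one_mulVec, add_sub_cancel_left]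

theorem Arho_sub_one_mulVec_eq_smul_DeltaQ (hq : (S.Arho * S.expAR ω + 1).det ≠ 0)
    (hΔ : S.DeltaC1 ω ≠ 0) {xr xb v : Fin (S.sys Block.Cr).order → ℝ}
    (hv : (1 + S.expAR ω) *ᵥ v = (S.Arho - 1) *ᵥ xr) (hxb : xb = xr + S.expAR ω *ᵥ v) :
    (S.Arho - 1) *ᵥ xr = (xb S.rho / S.DeltaC1 ω) • S.DeltaQ ω := by
  have hjump : (S.Arho * S.expAR ω + 1) *ᵥ v = (S.Arho - 1) *ᵥ xb := by
    rw [hxb, Matrix.mulVec_add, ← hv, Matrix.mulVec_mulVec, ← Matrix.add_mulVec]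
    congr 1
    noncomm_ring
  have hscale : (S.Arho - 1) *ᵥ xb =
      (xb S.rho / S.DeltaC1 ω) • ((S.Arho - 1) *ᵥ S.DeltaC ω) := by
    rw [Arho_sub_one_mulVec, Arho_sub_one_mulVec, smul_smul, ← DeltaC1]
    congr 1
    field_simp
  have hv' : v = (S.Arho * S.expAR ω + 1)⁻¹ *ᵥ
      ((xb S.rho / S.DeltaC1 ω) • ((S.Arho - 1) *ᵥ S.DeltaC ω)) := by
    rw [← hscale, ← hjump, Matrix.mulVec_mulVec,
      Matrix.nonsing_inv_mul _ (isUnit_iff_ne_zero.2 hq), Matrix.one_mulVec]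
  rw [← hv, hv', Matrix.mulVec_smul, Matrix.mulVec_smul, DeltaQ, Matrix.mulVec_mulVec,
    Matrix.mulVec_mulVec, mul_assoc]

theorem jump_sub_eq_Arho_sub_one_mulVec (i : Fin (S.sys Block.Cr).order) :
    S.jump (x (S.resetTime ω x inp)) ⟨Block.Cr, i⟩ - x (S.resetTime ω x inp) ⟨Block.Cr, i⟩ =
      ((S.Arho - 1) *ᵥ S.resetState ω x inp) i := by
  rw [Matrix.sub_mulVec, Matrix.one_mulVec]
  rfl

theorem hasDerivAt_resetResponse (t : ℝ) : HasDerivAt (S.resetResponse ω x inp)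
    ((S.sys Block.Cr).A *ᵥ S.resetResponse ω x inp t) t :=
  hasDerivAt_exp_sub_smul_mulVec _ _ _ t

theorem resetResponse_resetTime : S.resetResponse ω x inp (S.resetTime ω x inp) =
    (1 + S.expAR ω)⁻¹ *ᵥ ((S.Arho - 1) *ᵥ S.resetState ω x inp) :=
  exp_sub_self_smul_mulVec _ _ _

theorem resetResponse_resetTime_add :
    S.resetResponse ω x inp (S.resetTime ω x inp + Real.pi / ω) =
      S.expAR ω *ᵥ S.resetResponse ω x inp (S.resetTime ω x inp) := by
  rw [resetResponse_resetTime, resetResponse, add_sub_cancel_left]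
  rfl

namespace HalfWaveResponse

variable (H : HalfWaveResponse S ω R x inp)

include H

theorem one_add_expAR_mulVec_resetResponse (hfreq : S.NonResonant ω) :
    (1 + S.expAR ω) *ᵥ S.resetResponse ω x inp (S.resetTime ω x inp) =
      (S.Arho - 1) *ᵥ S.resetState ω x inp := by
  have hdet : (1 + S.expAR ω).det ≠ 0 :=
    det_one_add_exp_ne_zero _ H.pos (hfreq.det_pencil_ne_zero H.pos.ne' Block.Cr)
  rw [resetResponse_resetTime, Matrix.mulVec_mulVec,
    Matrix.mul_nonsing_inv _ (isUnit_iff_ne_zero.2 hdet), Matrix.one_mulVec]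

theorem baseLinearArc_resetTime (hfreq : S.NonResonant ω) :
    S.baseLinearArc ω x inp (S.resetTime ω x inp) =
      S.resetState ω x inp +
        S.expAR ω *ᵥ S.resetResponse ω x inp (S.resetTime ω x inp) := by
  have harc : (fun i => S.arc ω x inp (S.resetTime ω x inp) ⟨Block.Cr, i⟩) =
      S.resetState ω x inp + (S.Arho - 1) *ᵥ S.resetState ω x inp := by
    ext i
    rw [arc_resetTime, Pi.add_apply, ← jump_sub_eq_Arho_sub_one_mulVec]
    exact (add_sub_cancel _ _).symm
  rw [baseLinearArc, harc, ← H.one_add_expAR_mulVec_resetResponse hfreq, Matrix.add_mulVec,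
    Matrix.one_mulVec]
  abel

theorem baseLinearArc_resetTime_add (hfreq : S.NonResonant ω) :
    S.baseLinearArc ω x inp (S.resetTime ω x inp + Real.pi / ω) =
      -S.baseLinearArc ω x inp (S.resetTime ω x inp) := by
  rw [H.baseLinearArc_resetTime hfreq, baseLinearArc, arc_of_gt H.resetTime_lt, H.antiperiodic,
    resetResponse_resetTime_add, neg_add]
  rfl

theorem continuousOn_baseLinearArc : ContinuousOn (S.baseLinearArc ω x inp)
    (Icc (S.resetTime ω x inp) (S.resetTime ω x inp + Real.pi / ω)) :=
  (continuousOn_pi.2 fun i => continuousOn_pi.1 H.continuousOn_arc ⟨Block.Cr, i⟩).sub fun t _ =>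
    (hasDerivAt_resetResponse t).continuousAt.continuousWithinAt

theorem hasDerivAt_baseLinearArc {t : ℝ}
    (ht : t ∈ Ioo (S.resetTime ω x inp) (S.resetTime ω x inp + Real.pi / ω)) :
    HasDerivAt (S.baseLinearArc ω x inp)
      ((S.sys Block.Cr).A *ᵥ S.baseLinearArc ω x inp t + fun i => (S.sys Block.Cr).B i *
        S.solve (S.arc ω x inp t) (R * Real.sin (ω * t)) Block.Cr) t := by
  refine ((hasDerivAt_pi.2 fun i => hasDerivAt_pi.1 (H.hasDerivAt_arc ht)
    ⟨Block.Cr, i⟩).sub (hasDerivAt_resetResponse t)).congr_deriv ?_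
  ext i
  rw [← H.inp_eq_solve_arc ht.1, baseLinearArc, Matrix.mulVec_sub, arc_of_gt ht.1]
  simp only [field, Pi.sub_apply, Pi.add_apply]
  ring

theorem jump_sub_eq_resetAmplitude_mul (hfreq : S.NonResonant ω)
    (hq : (S.Arho * S.expAR ω + 1).det ≠ 0) (hΔ : S.DeltaC1 ω ≠ 0)
    (i : Fin (S.sys Block.Cr).order) :
    S.jump (x (S.resetTime ω x inp)) ⟨Block.Cr, i⟩ - x (S.resetTime ω x inp) ⟨Block.Cr, i⟩ =
      S.resetAmplitude ω x inp * S.DeltaQ ω i := by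
  rw [jump_sub_eq_Arho_sub_one_mulVec, Arho_sub_one_mulVec_eq_smul_DeltaQ hq hΔ
    (H.one_add_expAR_mulVec_resetResponse hfreq) (H.baseLinearArc_resetTime hfreq)]
  rfl

theorem hasSum_resetAmplitude_mul (hfreq : S.NonResonant ω) (hΔ : S.DeltaC1 ω ≠ 0) :
    HasSum (fun k : ℕ => (S.DeltaL ω (2 * k + 1) S.rho * inpPhasor ω inp (2 * k + 1) Block.Cr *
        Complex.exp (jw ω (2 * k + 1) * S.resetTime ω x inp)).im)
      (S.resetAmplitude ω x inp * S.DeltaC1 ω) := by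
  have hu := H.continuousOn_solve_arc Block.Cr
  have hanti := H.baseLinearArc_resetTime_add hfreq
  rw [resetAmplitude, div_mul_cancel₀ _ hΔ]
  refine (hasSum_im_expIntegral_mul_cexp H.pos (continuousOn_pi.1 H.continuousOn_baseLinearArc _)
    (fun t ht => hasDerivAt_pi.1 (H.hasDerivAt_baseLinearArc ht) S.rho)
    ((continuousOn_pi.1 (continuousOn_mulVec _ H.continuousOn_baseLinearArc) _).add
      (continuousOn_const.mul hu)) (congrFun hanti _)).congr_fun fun k => ?_
  have hodd := odd_two_mul_add_one k
  rw [(S.sys Block.Cr).expIntegral_eq_mul_stateTF H.pos H.continuousOn_baseLinearArc hu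
    (fun t ht => H.hasDerivAt_baseLinearArc ht) hanti hodd (hfreq Block.Cr _ hodd),
    H.inpPhasor_eq_expIntegral hodd, DeltaL]
  ring_nf

end HalfWaveResponse

end

end ResetLoop

/-! ### Moduli and phases -/

theorem cexp_arg_natCast_mul {z : ℂ} (hz : z ≠ 0) (n : ℕ) :
    Complex.exp (Complex.I * (n * z.arg : ℝ)) = (z / ‖z‖) ^ n := by
  have hexp : Complex.exp (z.arg * Complex.I) = z / ‖z‖ := by
    rw [eq_div_iff (by simpa using hz), mul_comm]
    exact Complex.norm_mul_exp_arg_mul_I z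
  rw [← hexp, ← Complex.exp_nat_mul]
  push_cast
  ring_nf

/-- The complex number `|z| e^{jn∠z}`: a reset element turns a first harmonic with phasor `z` into
an `n`-th harmonic with a phasor proportional to it. -/
noncomputable def phaseMul (n : ℕ) (z : ℂ) : ℂ :=
  ‖z‖ * Complex.exp (Complex.I * (n * z.arg : ℝ))

theorem phaseMul_eq_norm_mul_pow (n : ℕ) (z : ℂ) : phaseMul n z = ‖z‖ * (z / ‖z‖) ^ n := by
  rcases eq_or_ne z 0 with rfl | hz
  · simp [phaseMul]
  · rw [phaseMul, cexp_arg_natCast_mul hz]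

theorem phaseMul_mul (n : ℕ) (z w : ℂ) : phaseMul n (z * w) = phaseMul n z * phaseMul n w := by
  simp only [phaseMul_eq_norm_mul_pow, norm_mul, Complex.ofReal_mul, mul_div_mul_comm, mul_pow]
  ring

theorem phaseMul_one (z : ℂ) : phaseMul 1 z = z := by
  rw [phaseMul, Nat.cast_one, one_mul, mul_comm Complex.I, Complex.norm_mul_exp_arg_mul_I]

theorem phaseMul_ofReal {n : ℕ} (hn : Odd n) (r : ℝ) : phaseMul n r = r := by
  obtain ⟨k, rfl⟩ := hn
  rw [phaseMul_eq_norm_mul_pow, Complex.norm_real, Real.norm_eq_abs]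
  rcases eq_or_ne r 0 with rfl | hr
  · simp
  have hsq : ((r : ℂ) / (|r| : ℝ)) ^ 2 = 1 := by
    rw [div_pow, ← Complex.ofReal_pow, ← Complex.ofReal_pow, sq_abs, div_self (by simpa using hr)]
  rw [pow_succ, pow_mul, hsq, one_pow, one_mul, mul_div_cancel₀]
  simpa using hr

theorem mul_cexp_sub_one_mul_arg (n : ℕ) (z : ℂ) :
    z * Complex.exp (Complex.I * (((n : ℝ) - 1) * z.arg : ℝ)) = phaseMul n z := by
  conv_lhs => enter [1]; rw [← Complex.norm_mul_exp_arg_mul_I z]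
  rw [phaseMul, mul_assoc, ← Complex.exp_add]
  push_cast
  ring_nf

theorem norm_mul_sin_arg_add (z : ℂ) (φ : ℝ) :
    ‖z‖ * Real.sin (z.arg + φ) = (z * Complex.exp (Complex.I * φ)).im := by
  conv_rhs => enter [1, 1]; rw [← Complex.norm_mul_exp_arg_mul_I z]
  rw [mul_assoc, mul_comm Complex.I, ← Complex.exp_add, ← add_mul, ← Complex.ofReal_add,
    Complex.im_ofReal_mul, Complex.exp_ofReal_mul_I_im]

theorem norm_div_norm_mul_cexp_arg_sub (l w : ℂ) :
    (‖l‖ / ‖w‖ : ℂ) * Complex.exp (Complex.I * (l.arg - w.arg : ℝ)) = l / w := by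
  conv_rhs => rw [← Complex.norm_mul_exp_arg_mul_I l, ← Complex.norm_mul_exp_arg_mul_I w]
  rw [mul_div_mul_comm, ← Complex.exp_sub]
  push_cast
  ring_nf

namespace ResetLoop

section

variable {S : ResetLoop} {ω R : ℝ} {x : ℝ → S.Idx → ℝ} {inp : ℝ → Block → ℝ} {n : ℕ}

theorem DeltaC1_eq_im : S.DeltaC1 ω = (S.DeltaL ω 1 S.rho *
    Complex.exp (-(Complex.I * ((1 : ℕ) * (S.fr ω 1 Block.Cs).arg : ℝ)))).im := by
  rw [DeltaC1, DeltaC, sub_eq_add_neg, norm_mul_sin_arg_add]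
  simp

theorem Psi_mul_DeltaCn (n : ℕ) : S.Psi ω n * S.DeltaCn ω n =
    -(S.DeltaL ω n S.rho * (S.Lrho ω n / (1 + S.Ll ω n)) *
      Complex.exp (-(Complex.I * (n * (S.fr ω 1 Block.Cs).arg : ℝ)))).im := by
  have hφ : (S.DeltaL ω n S.rho).arg + (S.Lrho ω n).arg - (1 + S.Ll ω n).arg -
      n * (S.fr ω 1 Block.Cs).arg = (S.DeltaL ω n S.rho).arg +
        ((S.Lrho ω n).arg - (1 + S.Ll ω n).arg - n * (S.fr ω 1 Block.Cs).arg) := by ring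
  rw [Psi, DeltaCn, mul_neg, hφ, norm_mul_sin_arg_add, ← Complex.im_ofReal_mul,
    ← norm_div_norm_mul_cexp_arg_sub, Complex.ofReal_sub _ (n * _), mul_sub, sub_eq_add_neg,
    Complex.exp_add, Complex.ofReal_div]
  ring_nf

/-! ### The loop equations -/

namespace HalfWaveResponse

variable (H : HalfWaveResponse S ω R x inp)

include H

theorem inpPhasor_Cr : inpPhasor ω inp n Block.Cr = S.outPhasor ω x inp n Block.C1 :=
  congrArg (phasor ω n) (funext fun t => (H.steady.diagram t).zr_eq)

theorem phasor_trigger (hfreq : S.NonResonant ω) : phasor ω 1 (S.trigger x inp) =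
    S.fr ω 1 Block.Cs * inpPhasor ω inp 1 Block.Cr := by
  have hCs : inpPhasor ω inp 1 Block.Cs = S.outPhasor ω x inp 1 Block.C1 :=
    congrArg (phasor ω 1) (funext fun t => (H.steady.diagram t).zs_eq)
  rw [H.inpPhasor_Cr, ← hCs]
  exact H.outPhasor_of_ne hfreq odd_one (by decide)

theorem fr_Cs_ne_zero (hfreq : S.NonResonant ω) : S.fr ω 1 Block.Cs ≠ 0 :=
  left_ne_zero_of_mul (H.phasor_trigger hfreq ▸ H.twoReset.first_ne_zero)

theorem inpPhasor_Cr_ne_zero (hfreq : S.NonResonant ω) : inpPhasor ω inp 1 Block.Cr ≠ 0 :=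
  right_ne_zero_of_mul (H.phasor_trigger hfreq ▸ H.twoReset.first_ne_zero)

theorem cexp_neg_jw_mul_resetTime (hfreq : S.NonResonant ω) (n : ℕ) :
    Complex.exp (-(jw ω n * S.resetTime ω x inp)) =
      Complex.exp (Complex.I * (n * (S.fr ω 1 Block.Cs).arg : ℝ)) *
        Complex.exp (Complex.I * (n * (inpPhasor ω inp 1 Block.Cr).arg : ℝ)) := by
  have hCs := H.fr_Cs_ne_zero hfreq
  have hZ := H.inpPhasor_Cr_ne_zero hfreq
  have harg : -(jw ω n * S.resetTime ω x inp) = Complex.I *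
      (n * (S.fr ω 1 Block.Cs * inpPhasor ω inp 1 Block.Cr).arg : ℝ) := by
    have hω : (ω : ℂ) ≠ 0 := by exact_mod_cast H.pos.ne'
    rw [resetTime, H.phasor_trigger hfreq, jw]
    push_cast
    field_simp
  rw [harg, cexp_arg_natCast_mul (mul_ne_zero hCs hZ), cexp_arg_natCast_mul hCs,
    cexp_arg_natCast_mul hZ, ← mul_pow, norm_mul, Complex.ofReal_mul, mul_div_mul_comm]

theorem outPhasor_Cr (hfreq : S.NonResonant ω) (hq : (S.Arho * S.expAR ω + 1).det ≠ 0)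
    (hΔ : S.DeltaC1 ω ≠ 0) (hn : Odd n) :
    S.outPhasor ω x inp n Block.Cr = S.fr ω n Block.Cr * inpPhasor ω inp n Block.Cr +
      S.resetAmplitude ω x inp * S.Crho ω n *
        Complex.exp (Complex.I * (n * (inpPhasor ω inp 1 Block.Cr).arg : ℝ)) := by
  have hstate : (S.sys Block.Cr).charMat (jw ω n) *ᵥ S.statePhasor ω x n Block.Cr =
      inpPhasor ω inp n Block.Cr • (fun i => ((S.sys Block.Cr).B i : ℂ)) +
        (2 * Complex.I * (ω / Real.pi) * Complex.exp (-(jw ω n * S.resetTime ω x inp)) *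
          S.resetAmplitude ω x inp) • fun i => (S.DeltaQ ω i : ℂ) := by
    rw [H.charMat_mulVec_statePhasor hn]
    ext i
    rw [H.jump_sub_eq_resetAmplitude_mul hfreq hq hΔ]
    simp only [Pi.add_apply, Pi.smul_apply, smul_eq_mul]
    push_cast
    ring
  have hn0 : (n : ℂ) ≠ 0 := by exact_mod_cast hn.pos.ne'
  have hπ : (Real.pi : ℂ) ≠ 0 := by exact_mod_cast Real.pi_pos.ne'
  have htf : S.fr ω n Block.Cr = (fun i => ((S.sys Block.Cr).C i : ℂ)) ⬝ᵥ
      (((S.sys Block.Cr).charMat (jw ω n))⁻¹ *ᵥ fun i => ((S.sys Block.Cr).B i : ℂ)) +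
        (S.sys Block.Cr).D := rfl
  rw [H.outPhasor_eq, eq_inv_mulVec_of_mulVec_eq (hfreq Block.Cr n hn) hstate, Matrix.mulVec_add,
    Matrix.mulVec_smul, Matrix.mulVec_smul, dotProduct_add, dotProduct_smul, dotProduct_smul,
    H.cexp_neg_jw_mul_resetTime hfreq, htf, Crho, DeltaX, smul_dotProduct,
    ← Matrix.dotProduct_mulVec]
  simp only [smul_eq_mul]
  generalize Complex.exp (Complex.I * (n * (S.fr ω 1 Block.Cs).arg : ℝ)) = θ
  rw [jw]
  push_cast
  field_simp
  ring

theorem inpPhasor_Cr_eq_mul (hfreq : S.NonResonant ω) (hn : Odd n) :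
    inpPhasor ω inp n Block.Cr = S.fr ω n Block.C1 * inpPhasor ω inp n Block.C1 := by
  rw [H.inpPhasor_Cr, H.outPhasor_of_ne hfreq hn (by decide)]

theorem inpPhasor_P_eq (hfreq : S.NonResonant ω) (hq : (S.Arho * S.expAR ω + 1).det ≠ 0)
    (hΔ : S.DeltaC1 ω ≠ 0) (hn : Odd n) :
    inpPhasor ω inp n Block.P = S.fr ω n Block.C3 *
      ((S.fr ω n Block.Cr + S.fr ω n Block.C2) * inpPhasor ω inp n Block.Cr +
        S.resetAmplitude ω x inp * S.Crho ω n *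
          Complex.exp (Complex.I * (n * (inpPhasor ω inp 1 Block.Cr).arg : ℝ))) := by
  have hP : inpPhasor ω inp n Block.P = S.outPhasor ω x inp n Block.C3 :=
    congrArg (phasor ω n) (funext fun t => (H.steady.diagram t).u_eq)
  have hC2 : inpPhasor ω inp n Block.C2 = S.outPhasor ω x inp n Block.C1 :=
    congrArg (phasor ω n) (funext fun t => (H.steady.diagram t).z2_eq)
  rw [hP, H.outPhasor_of_ne hfreq hn (by decide), H.inpPhasor_C3, H.outPhasor_Cr hfreq hq hΔ hn,
    H.outPhasor_of_ne hfreq hn (by decide), hC2, ← H.inpPhasor_Cr]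
  ring

theorem inpPhasor_C4_eq_mul (hfreq : S.NonResonant ω) (hn : Odd n) :
    inpPhasor ω inp n Block.C4 = S.fr ω n Block.P * inpPhasor ω inp n Block.P := by
  have hC4 : inpPhasor ω inp n Block.C4 = S.outPhasor ω x inp n Block.P :=
    congrArg (phasor ω n) (funext fun t => (H.steady.diagram t).y_eq)
  rw [hC4, H.outPhasor_of_ne hfreq hn (by decide)]

theorem inpPhasor_C1_eq (hfreq : S.NonResonant ω) (hn : Odd n) :
    inpPhasor ω inp n Block.C1 =
      (if n = 1 then (R : ℂ) else 0) - S.fr ω n Block.C4 * inpPhasor ω inp n Block.C4 := by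
  rw [← H.outPhasor_of_ne hfreq hn (by decide), ← H.inpPhasor_C1_add, add_sub_cancel_right]

theorem inpPhasor_Cr_mul_one_add_Ll (hfreq : S.NonResonant ω)
    (hq : (S.Arho * S.expAR ω + 1).det ≠ 0) (hΔ : S.DeltaC1 ω ≠ 0) (hn : Odd n) (hn1 : n ≠ 1) :
    inpPhasor ω inp n Block.Cr * (1 + S.Ll ω n) =
      -(S.resetAmplitude ω x inp * S.Lrho ω n *
        Complex.exp (Complex.I * (n * (inpPhasor ω inp 1 Block.Cr).arg : ℝ))) := by
  have hC1 := H.inpPhasor_C1_eq hfreq hn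
  rw [if_neg hn1] at hC1
  rw [Ll, Lrho]
  linear_combination H.inpPhasor_Cr_eq_mul hfreq hn + S.fr ω n Block.C1 * hC1 -
    S.fr ω n Block.C1 * S.fr ω n Block.C4 * H.inpPhasor_C4_eq_mul hfreq hn -
    S.fr ω n Block.C1 * S.fr ω n Block.C4 * S.fr ω n Block.P * H.inpPhasor_P_eq hfreq hq hΔ hn

/-! ### Harmonic balance at the reset instants -/

theorem cexp_jw_mul_resetTime (hfreq : S.NonResonant ω) (n : ℕ) :
    Complex.exp (jw ω n * S.resetTime ω x inp) =
      Complex.exp (-(Complex.I * (n * (S.fr ω 1 Block.Cs).arg : ℝ))) *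
        (Complex.exp (Complex.I * (n * (inpPhasor ω inp 1 Block.Cr).arg : ℝ)))⁻¹ := by
  rw [← inv_inj, ← Complex.exp_neg, H.cexp_neg_jw_mul_resetTime hfreq, mul_inv, inv_inv,
    Complex.exp_neg, inv_inv]

theorem im_DeltaL_mul_inpPhasor_Cr_one (hfreq : S.NonResonant ω) :
    (S.DeltaL ω 1 S.rho * inpPhasor ω inp 1 Block.Cr *
      Complex.exp (jw ω 1 * S.resetTime ω x inp)).im =
        ‖inpPhasor ω inp 1 Block.Cr‖ * S.DeltaC1 ω := by
  rw [DeltaC1_eq_im, ← Complex.im_ofReal_mul, H.cexp_jw_mul_resetTime hfreq]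
  conv_lhs => enter [1, 1, 2]; rw [← phaseMul_one (inpPhasor ω inp 1 Block.Cr), phaseMul]
  congr 1
  field_simp [Complex.exp_ne_zero]

theorem im_DeltaL_mul_inpPhasor_Cr (hfreq : S.NonResonant ω)
    (hq : (S.Arho * S.expAR ω + 1).det ≠ 0) (hΔ : S.DeltaC1 ω ≠ 0) (hn : Odd n) (hn1 : n ≠ 1)
    (hL : 1 + S.Ll ω n ≠ 0) : (S.DeltaL ω n S.rho * inpPhasor ω inp n Block.Cr *
      Complex.exp (jw ω n * S.resetTime ω x inp)).im =
        S.resetAmplitude ω x inp * (S.Psi ω n * S.DeltaCn ω n) := by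
  rw [Psi_mul_DeltaCn, mul_neg, ← Complex.im_ofReal_mul, ← Complex.neg_im,
    H.cexp_jw_mul_resetTime hfreq,
    eq_div_of_mul_eq hL (H.inpPhasor_Cr_mul_one_add_Ll hfreq hq hΔ hn hn1)]
  congr 1
  field_simp [Complex.exp_ne_zero]

section

variable (hfreq : S.NonResonant ω) (hq : (S.Arho * S.expAR ω + 1).det ≠ 0)
  (hΔ : S.DeltaC1 ω ≠ 0) (hL : ∀ n, Odd n → 1 + S.Ll ω n ≠ 0)

include hfreq hq hΔ hL

theorem hasSum_resetAmplitude_mul_Psi_mul_DeltaCn :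
    HasSum (fun k : ℕ => S.resetAmplitude ω x inp *
        (S.Psi ω (2 * k + 3) * S.DeltaCn ω (2 * k + 3)))
      (S.resetAmplitude ω x inp * S.DeltaC1 ω -
        ‖inpPhasor ω inp 1 Block.Cr‖ * S.DeltaC1 ω) := by
  have htail := (hasSum_nat_add_iff' 1).2 (H.hasSum_resetAmplitude_mul hfreq hΔ)
  rw [Finset.sum_range_one, mul_zero, zero_add, H.im_DeltaL_mul_inpPhasor_Cr_one hfreq] at htail
  refine htail.congr_fun fun k => ?_
  have hodd : Odd (2 * k + 3) := ⟨k + 1, by ring⟩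
  rw [show 2 * (k + 1) + 1 = 2 * k + 3 by ring,
    H.im_DeltaL_mul_inpPhasor_Cr hfreq hq hΔ hodd (by omega) (hL _ hodd)]

theorem resetAmplitude_ne_zero : S.resetAmplitude ω x inp ≠ 0 := by
  intro h0
  have hsum := H.hasSum_resetAmplitude_mul_Psi_mul_DeltaCn hfreq hq hΔ hL
  simp only [h0, zero_mul, zero_sub] at hsum
  exact neg_ne_zero.2 (mul_ne_zero (norm_ne_zero_iff.2 (H.inpPhasor_Cr_ne_zero hfreq)) hΔ)
    (hsum.unique hasSum_zero)

theorem summable_Psi_mul_DeltaCn :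
    Summable fun k : ℕ => S.Psi ω (2 * k + 3) * S.DeltaCn ω (2 * k + 3) :=
  (summable_mul_left_iff (H.resetAmplitude_ne_zero hfreq hq hΔ hL)).1
    (H.hasSum_resetAmplitude_mul_Psi_mul_DeltaCn hfreq hq hΔ hL).summable

theorem resetAmplitude_mul_one_sub :
    S.resetAmplitude ω x inp * (1 - S.PsiSum ω / S.DeltaC1 ω) =
      ‖inpPhasor ω inp 1 Block.Cr‖ := by
  have hsum := (H.hasSum_resetAmplitude_mul_Psi_mul_DeltaCn hfreq hq hΔ hL).tsum_eq
  rw [tsum_mul_left, ← PsiSum] at hsum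
  field_simp
  linear_combination -hsum

theorem one_sub_PsiSum_div_ne_zero : 1 - S.PsiSum ω / S.DeltaC1 ω ≠ 0 :=
  right_ne_zero_of_mul (H.resetAmplitude_mul_one_sub hfreq hq hΔ hL ▸
    norm_ne_zero_iff.2 (H.inpPhasor_Cr_ne_zero hfreq))

theorem resetAmplitude_eq :
    S.resetAmplitude ω x inp = S.Gam ω * ‖inpPhasor ω inp 1 Block.Cr‖ := by
  rw [Gam, one_div_mul_eq_div, eq_div_iff (H.one_sub_PsiSum_div_ne_zero hfreq hq hΔ hL),
    H.resetAmplitude_mul_one_sub hfreq hq hΔ hL]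

end

end HalfWaveResponse

end

end ResetLoop

/-! ### The describing functions -/

namespace ResetLoop

section

variable {S : ResetLoop} {ω R : ℝ} {x : ℝ → S.Idx → ℝ} {inp : ℝ → Block → ℝ} {n : ℕ}

theorem HBetaOnHarmonics.one_add_Ll_ne_zero (hβ : S.HBetaOnHarmonics ω) (hS : S.NoFeedthrough)
    (hfreq : S.NonResonant ω) (hn : Odd n) : 1 + S.Ll ω n ≠ 0 := by
  obtain ⟨Acl, czs, -, -, hbl, hdet, -⟩ := hβ
  refine ResetLoop.one_add_Ll_ne_zero hS hbl ?_ fun b => hfreq b n hn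
  simpa only [Int.cast_natCast, jw] using hdet n

theorem Lo_eq : S.Lo ω =
    (S.fr ω 1 Block.Cr + S.fr ω 1 Block.C2 + S.Gam ω * S.Crho ω 1) * S.fr ω 1 Block.C3 *
      S.fr ω 1 Block.P * S.fr ω 1 Block.C4 * S.fr ω 1 Block.C1 := by
  rw [Lo, Ln, Lrho, if_pos rfl]
  ring

theorem Ln_of_odd (hn : Odd n) (hn1 : n ≠ 1) : S.Ln ω n =
    phaseMul n (S.fr ω 1 Block.C1) * S.Crho ω n * S.fr ω n Block.C3 * S.fr ω n Block.P := by
  rw [Ln, if_neg hn1, if_pos hn, mul_cexp_sub_one_mul_arg]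

namespace HalfWaveResponse

variable (H : HalfWaveResponse S ω R x inp)

include H

theorem hosidf_inp (hn : n ≠ 0) (b : Block) :
    hosidf ω R (fun t => inp t b) n = inpPhasor ω inp n b / R :=
  hosidf_eq H.pos.ne' R _ hn

theorem hosidf_of_even (hn : Even n) (hn0 : n ≠ 0) (b : Block) :
    hosidf ω R (fun t => inp t b) n = 0 := by
  rw [H.hosidf_inp hn0, H.inpPhasor_of_even hn, zero_div]

section

variable (hR : R ≠ 0) (hfreq : S.NonResonant ω) (hq : (S.Arho * S.expAR ω + 1).det ≠ 0)
  (hΔ : S.DeltaC1 ω ≠ 0) (hL : ∀ n, Odd n → 1 + S.Ll ω n ≠ 0)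

include hfreq hq hΔ hL

theorem resetAmplitude_mul_cexp (n : ℕ) : S.resetAmplitude ω x inp *
    Complex.exp (Complex.I * (n * (inpPhasor ω inp 1 Block.Cr).arg : ℝ)) =
      S.Gam ω * phaseMul n (inpPhasor ω inp 1 Block.Cr) := by
  rw [H.resetAmplitude_eq hfreq hq hΔ hL, phaseMul, Complex.ofReal_mul, mul_assoc]

theorem inpPhasor_C1_one_mul : inpPhasor ω inp 1 Block.C1 * (1 + S.Lo ω) = R := by
  have hκ := H.resetAmplitude_mul_cexp hfreq hq hΔ hL 1
  have hC1 := H.inpPhasor_C1_eq hfreq odd_one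
  rw [phaseMul_one] at hκ
  rw [if_pos rfl] at hC1
  rw [Lo_eq]
  linear_combination hC1 - S.fr ω 1 Block.C4 * H.inpPhasor_C4_eq_mul hfreq odd_one -
    S.fr ω 1 Block.C4 * S.fr ω 1 Block.P * H.inpPhasor_P_eq hfreq hq hΔ odd_one -
    S.fr ω 1 Block.C4 * S.fr ω 1 Block.P * S.fr ω 1 Block.C3 * S.Crho ω 1 * hκ -
    S.fr ω 1 Block.C4 * S.fr ω 1 Block.P * S.fr ω 1 Block.C3 *
      (S.fr ω 1 Block.Cr + S.fr ω 1 Block.C2 + S.Gam ω * S.Crho ω 1) *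
        H.inpPhasor_Cr_eq_mul hfreq odd_one

include hR

theorem one_add_Lo_ne_zero : 1 + S.Lo ω ≠ 0 :=
  right_ne_zero_of_mul (H.inpPhasor_C1_one_mul hfreq hq hΔ hL ▸ Complex.ofReal_ne_zero.2 hR)

theorem hosidf_C1_one : hosidf ω R (fun t => inp t Block.C1) 1 = 1 / (1 + S.Lo ω) := by
  have hR' : (R : ℂ) ≠ 0 := Complex.ofReal_ne_zero.2 hR
  rw [H.hosidf_inp one_ne_zero, div_eq_div_iff hR' (H.one_add_Lo_ne_zero hR hfreq hq hΔ hL),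
    H.inpPhasor_C1_one_mul hfreq hq hΔ hL, one_mul]

theorem hosidf_C4_one (hC4 : S.fr ω 1 Block.C4 ≠ 0) : hosidf ω R (fun t => inp t Block.C4) 1 =
    S.Lo ω / (S.fr ω 1 Block.C4 * (1 + S.Lo ω)) := by
  have hR' : (R : ℂ) ≠ 0 := Complex.ofReal_ne_zero.2 hR
  have hLo := H.one_add_Lo_ne_zero hR hfreq hq hΔ hL
  have hC1 := H.inpPhasor_C1_eq hfreq odd_one
  rw [if_pos rfl] at hC1
  rw [H.hosidf_inp one_ne_zero, div_eq_div_iff hR' (mul_ne_zero hC4 hLo)]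
  linear_combination (1 + S.Lo ω) * hC1 - H.inpPhasor_C1_one_mul hfreq hq hΔ hL

theorem phaseMul_inpPhasor_Cr (hn : Odd n) : phaseMul n (inpPhasor ω inp 1 Block.Cr) =
    phaseMul n (S.fr ω 1 Block.C1) * (R * phaseMul n (S.S1 ω)) := by
  have hC1 : inpPhasor ω inp 1 Block.C1 = R * S.S1 ω := by
    rw [S1, mul_one_div, eq_div_iff (H.one_add_Lo_ne_zero hR hfreq hq hΔ hL),
      H.inpPhasor_C1_one_mul hfreq hq hΔ hL]
  rw [H.inpPhasor_Cr_eq_mul hfreq odd_one, hC1, phaseMul_mul, phaseMul_mul, phaseMul_ofReal hn]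

theorem hosidf_C4_of_odd (hn : Odd n) (hn1 : n ≠ 1) :
    hosidf ω R (fun t => inp t Block.C4) n = S.hoFactor ω n := by
  have hR' : (R : ℂ) ≠ 0 := Complex.ofReal_ne_zero.2 hR
  have hLn := hL n hn
  have hκ := H.resetAmplitude_mul_cexp hfreq hq hΔ hL n
  have hC1 := H.inpPhasor_C1_eq hfreq hn
  rw [if_neg hn1] at hC1
  rw [H.phaseMul_inpPhasor_Cr hR hfreq hq hΔ hL hn] at hκ
  have hC4 : inpPhasor ω inp n Block.C4 * (1 + S.Ll ω n) =
      R * (phaseMul n (S.S1 ω) * S.Gam ω * S.Ln ω n) := by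
    rw [Ll, Ln_of_odd hn hn1]
    linear_combination H.inpPhasor_C4_eq_mul hfreq hn +
      S.fr ω n Block.P * H.inpPhasor_P_eq hfreq hq hΔ hn +
      S.fr ω n Block.P * S.fr ω n Block.C3 * (S.fr ω n Block.Cr + S.fr ω n Block.C2) *
        (H.inpPhasor_Cr_eq_mul hfreq hn + S.fr ω n Block.C1 * hC1) +
      S.fr ω n Block.P * S.fr ω n Block.C3 * S.Crho ω n * hκ
  rw [H.hosidf_inp hn.pos.ne', div_eq_iff hR', eq_div_of_mul_eq hLn hC4, hoFactor, Sl, ← phaseMul]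
  ring

theorem hosidf_C1_of_odd (hn : Odd n) (hn1 : n ≠ 1) :
    hosidf ω R (fun t => inp t Block.C1) n = -(S.hoFactor ω n * S.fr ω n Block.C4) := by
  rw [← H.hosidf_C4_of_odd hR hfreq hq hΔ hL hn hn1, H.hosidf_inp hn.pos.ne',
    H.hosidf_inp hn.pos.ne', H.inpPhasor_C1_eq hfreq hn, if_neg hn1]
  ring

end

theorem hosidf_P_eq_div (hfreq : S.NonResonant ω) (hn : Odd n) (hP : S.fr ω n Block.P ≠ 0) :
    hosidf ω R (fun t => inp t Block.P) n =
      hosidf ω R (fun t => inp t Block.C4) n / S.fr ω n Block.P := by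
  rw [H.hosidf_inp hn.pos.ne', H.hosidf_inp hn.pos.ne', H.inpPhasor_C4_eq_mul hfreq hn,
    mul_div_assoc, mul_div_cancel_left₀ _ hP]

end HalfWaveResponse

end

end ResetLoop

end

theorem theorem2_general (S : ResetLoop) (ω R : ℝ) (hω : 0 < ω) (hR : R ≠ 0)
    (hS : S.NoFeedthrough) (hβ : S.HBetaOnHarmonics ω)
    (x : ℝ → S.Idx → ℝ) (inp : ℝ → Block → ℝ)
    (hss : S.IsSteadyState ω R x inp) (htwo : S.IsTwoReset ω x inp)
    (hfreq : S.NonResonant ω) (hq : (S.Arho * S.expAR ω + 1).det ≠ 0) (hΔ : S.DeltaC1 ω ≠ 0) :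
    ((∀ n : ℕ, Odd n → 1 + S.Ll ω n ≠ 0) ∧
      Summable (fun k : ℕ => S.Psi ω (2 * k + 3) * S.DeltaCn ω (2 * k + 3)) ∧
      1 - S.PsiSum ω / S.DeltaC1 ω ≠ 0 ∧ 1 + S.Lo ω ≠ 0) ∧
    (hosidf ω R (fun t => inp t Block.C1) 1 = 1 / (1 + S.Lo ω) ∧
      (∀ n : ℕ, Odd n → 1 < n →
        hosidf ω R (fun t => inp t Block.C1) n = -(S.hoFactor ω n * S.fr ω n Block.C4)) ∧
      (∀ n : ℕ, Even n → 2 ≤ n → hosidf ω R (fun t => inp t Block.C1) n = 0)) ∧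
    ((S.fr ω 1 Block.C4 ≠ 0 →
        hosidf ω R (fun t => inp t Block.C4) 1 =
          S.Lo ω / (S.fr ω 1 Block.C4 * (1 + S.Lo ω))) ∧
      (∀ n : ℕ, Odd n → 1 < n →
        hosidf ω R (fun t => inp t Block.C4) n = S.hoFactor ω n) ∧
      (∀ n : ℕ, Even n → 2 ≤ n → hosidf ω R (fun t => inp t Block.C4) n = 0)) ∧
    ((S.fr ω 1 Block.C4 ≠ 0 → S.fr ω 1 Block.P ≠ 0 →
        hosidf ω R (fun t => inp t Block.P) 1 =
          S.Lo ω / (S.fr ω 1 Block.C4 * S.fr ω 1 Block.P * (1 + S.Lo ω))) ∧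
      (∀ n : ℕ, Odd n → 1 < n → S.fr ω n Block.P ≠ 0 →
        hosidf ω R (fun t => inp t Block.P) n = S.hoFactor ω n / S.fr ω n Block.P) ∧
      (∀ n : ℕ, Even n → 2 ≤ n → hosidf ω R (fun t => inp t Block.P) n = 0)) := by
  have H : S.HalfWaveResponse ω R x inp :=
    ⟨hω, hS, hss, htwo, hss.antiperiodic htwo hω hS hβ⟩
  have hL : ∀ n, Odd n → 1 + S.Ll ω n ≠ 0 := fun _ hn => hβ.one_add_Ll_ne_zero hS hfreq hn
  have hC4 := fun n hn (hn1 : 1 < n) => H.hosidf_C4_of_odd (n := n) hR hfreq hq hΔ hL hn hn1.ne'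
  have heven := fun b n hn (hn2 : 2 ≤ n) => H.hosidf_of_even (n := n) hn (by omega) b
  refine ⟨⟨hL, H.summable_Psi_mul_DeltaCn hfreq hq hΔ hL,
      H.one_sub_PsiSum_div_ne_zero hfreq hq hΔ hL, H.one_add_Lo_ne_zero hR hfreq hq hΔ hL⟩,
    ⟨H.hosidf_C1_one hR hfreq hq hΔ hL,
      fun n hn hn1 => H.hosidf_C1_of_odd hR hfreq hq hΔ hL hn hn1.ne', heven _⟩,
    ⟨H.hosidf_C4_one hR hfreq hq hΔ hL, hC4, heven _⟩,
    ⟨fun h4 hP => ?_, fun n hn hn1 hP => ?_, heven _⟩⟩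
  · rw [H.hosidf_P_eq_div hfreq odd_one hP, H.hosidf_C4_one hR hfreq hq hΔ hL h4, div_div,
      mul_right_comm]
  · rw [H.hosidf_P_eq_div hfreq hn hP, hC4 n hn hn1]

theorem theorem2 (S : ResetLoop) (ω R : ℝ) (hω : 0 < ω) (hR : 0 < R)
    -- no direct feedthrough around the loop
    (hproper : (S.sys Block.C1).D * (S.sys Block.C3).D * (S.sys Block.P).D
      * (S.sys Block.C4).D = 0)
    (hβ : S.HBeta)
    (x : ℝ → S.Idx → ℝ) (inp : ℝ → Block → ℝ)
    (hss : S.IsSteadyState ω R x inp) (htwo : S.IsTwoReset ω x inp)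
    -- the frequency responses, `Δ_q` and the division by `Δ_c¹` are meaningful
    (hfreq : ∀ b : Block, ∀ n : ℕ, Odd n → ((S.sys b).charMat (ResetLoop.jw ω n)).det ≠ 0)
    (hq : (S.Arho * S.expAR ω + 1).det ≠ 0)
    (hΔ : S.DeltaC1 ω ≠ 0) :
    -- all the expressions below are well defined
    ((∀ n : ℕ, Odd n → 1 + S.Ll ω n ≠ 0) ∧
      Summable (fun k : ℕ => S.Psi ω (2 * k + 3) * S.DeltaCn ω (2 * k + 3)) ∧
      1 - S.PsiSum ω / S.DeltaC1 ω ≠ 0 ∧ 1 + S.Lo ω ≠ 0) ∧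
    -- sensitivity `E^n / R^n`
    (hosidf ω R (fun t => inp t Block.C1) 1 = 1 / (1 + S.Lo ω) ∧
      (∀ n : ℕ, Odd n → 1 < n →
        hosidf ω R (fun t => inp t Block.C1) n = -(S.hoFactor ω n * S.fr ω n Block.C4)) ∧
      (∀ n : ℕ, Even n → 2 ≤ n → hosidf ω R (fun t => inp t Block.C1) n = 0)) ∧
    -- complementary sensitivity `Y^n / R^n`
    ((S.fr ω 1 Block.C4 ≠ 0 →
        hosidf ω R (fun t => inp t Block.C4) 1 =
          S.Lo ω / (S.fr ω 1 Block.C4 * (1 + S.Lo ω))) ∧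
      (∀ n : ℕ, Odd n → 1 < n →
        hosidf ω R (fun t => inp t Block.C4) n = S.hoFactor ω n) ∧
      (∀ n : ℕ, Even n → 2 ≤ n → hosidf ω R (fun t => inp t Block.C4) n = 0)) ∧
    -- control sensitivity `U^n / R^n`
    ((S.fr ω 1 Block.C4 ≠ 0 → S.fr ω 1 Block.P ≠ 0 →
        hosidf ω R (fun t => inp t Block.P) 1 =
          S.Lo ω / (S.fr ω 1 Block.C4 * S.fr ω 1 Block.P * (1 + S.Lo ω))) ∧
      (∀ n : ℕ, Odd n → 1 < n → S.fr ω n Block.P ≠ 0 →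
        hosidf ω R (fun t => inp t Block.P) n = S.hoFactor ω n / S.fr ω n Block.P) ∧
      (∀ n : ℕ, Even n → 2 ≤ n → hosidf ω R (fun t => inp t Block.P) n = 0)) :=
  theorem2_general S ω R hω hR.ne' hproper (hβ.onHarmonics ω) x inp hss htwo hfreq hq hΔ
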